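/- Let $\Sigma_I$ and $\Sigma_O$ be fixed finite non-empty alphabets of input and output signals, taken to be disjoint. Languages are subsets of $(\Sigma_I\cdot\Sigma_O)^\omega$; $w_i$ is the $i$-th symbol of $w$ and $w_{\le i}$ its prefix of length $i$. A *controller strategy* is a map $\sigma_\exists\colon(\Sigma_I\cdot\Sigma_O)^*\cdot\Sigma_I\to\Sigma_O$, and $\mathrm{Out}(\sigma_\exists)$ is the set of words $w$ with $w_{2i+2}=\sigma_\exists(w_{\le 2i+1})$ for all $i\in\mathbb N$; an *environment strategy* is a map $\sigma_\forall\colon(\Sigma_I\cdot\Sigma_O)^*\to\Sigma_I$, and $\mathrm{Out}(\sigma_\forall)$ is the set of words $w$ with $w_{2i+1}=\sigma_\forall(w_{\le 2i})$ for all $i\in\mathbb N$. A *parity automaton* is a deterministic (possibly incomplete) automaton with finitely many states, reading letters of $\Sigma_I\cup\Sigma_O$, with a colouring of the states by natural numbers. It accepts an infinite word if the word labels an infinite path from the initial state along which the smallest colour seen infinitely often is even, and it recognises the set of all the words that it accepts. Its *size* is the number of bits of its description as a table of colours and transitions, with numbers in binary. A language $A$ is *ensurable* if for every $h\in(\Sigma_I\cdot\Sigma_O)^*$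 that is a prefix of a word of $A$ there is an environment strategy $\sigma_\forall$ such that $h$ is a prefix of a word of $\mathrm{Out}(\sigma_\forall)$ and $\mathrm{Out}(\sigma_\forall)\subseteq A$. A language $A$ is *sufficient* for a specification $L$ and a scenario $S$ if there is a controller strategy $\sigma_\exists$ with $S\subseteq A\cap\mathrm{Out}(\sigma_\exists)\subseteq L$. It is *ensurable-optimal* for $L$ and $S$ if it is ensurable and sufficient for $L$ and $S$, and no ensurable language $B\supsetneq A$ is sufficient for $L$ and $S$. A scenario $S$ is *coherent* if any two words of $S$ with a common prefix in $(\Sigma_I\cdot\Sigma_O)^*\cdot\Sigma_I$ have the same next output. **Theorem.** There are an algorithm and polynomials $T,R$ such that the following holds. Given parity automata recognising a specification $L\subseteq(\Sigma_I\cdot\Sigma_O)^\omega$ and a coherent scenario $S\subseteq L$, of total size $s$, the algorithm computes in at most $2^{T(s)}$ steps a parity automaton of size at most $R(s)$ that recognises an ensurable-optimal assumption for $L$ and $S$. -/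

import Mathlib

namespace Synthesis

/-! ### Words, strategies and assumptions -/

section Games

variable {I O : Type}

/-- An infinite word of `(Σ_I · Σ_O)^ω`: the `k`-th round `w k` is the pair made of the `k`-th input
signal and of the `k`-th output signal. -/
abbrev IOWord (I O : Type) : Type := ℕ → I × O

/-- A language of `(Σ_I · Σ_O)^ω`. -/
abbrev IOLang (I O : Type) : Type := Set (IOWord I O)

/-- The word over the disjoint union of the two alphabets that is read signal by signal:
input, output, input, output, … -/
def IOWord.letters (w : IOWord I O) (n : ℕ) : I ⊕ O :=
  if n % 2 = 0 then Sum.inl (w (n / 2)).1 else Sum.inr (w (n / 2)).2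

/-- The prefix of `w` made of its first `k` rounds, a word of `(Σ_I · Σ_O)^*`. -/
def IOWord.take (w : IOWord I O) (k : ℕ) : List (I × O) :=
  (List.range k).map w

/-- The finite word `h` of `(Σ_I · Σ_O)^*` is a prefix of `w`, that is `w ∈ h · (Σ_I · Σ_O)^ω`. -/
def IOWord.HasPrefix (w : IOWord I O) (h : List (I × O)) : Prop :=
  w.take h.length = h

/-- A strategy of the controller, a map from `(Σ_I · Σ_O)^* · Σ_I` to `Σ_O`. -/
abbrev Strategy (I O : Type) : Type := List (I × O) → I → O

/-- A strategy of the environment, a map from `(Σ_I · Σ_O)^*` to `Σ_I`. -/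
abbrev EnvStrategy (I O : Type) : Type := List (I × O) → I

/-- The outcomes of a strategy of the controller. -/
def Strategy.Out (σ : Strategy I O) : IOLang I O :=
  {w | ∀ k, (w k).2 = σ (w.take k) (w k).1}

/-- The outcomes of a strategy of the environment. -/
def EnvStrategy.Out (τ : EnvStrategy I O) : IOLang I O :=
  {w | ∀ k, (w k).1 = τ (w.take k)}

/-- `A` is ensurable: from every finite word that can be prolonged into a word of `A`, the
environment has a strategy which is compatible with that word and has all its outcomes in `A`. -/
def Ensurable (A : IOLang I O) : Prop :=
  ∀ h : List (I × O), (∃ w ∈ A, w.HasPrefix h) →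
    ∃ τ : EnvStrategy I O, (∃ w ∈ τ.Out, w.HasPrefix h) ∧ τ.Out ⊆ A

/-- The scenario `S` is coherent: two words of `S` that agree up to some input also agree on the
output that follows. -/
def Coherent (S : IOLang I O) : Prop :=
  ∀ w ∈ S, ∀ w' ∈ S, ∀ k, w.take k = w'.take k → (w k).1 = (w' k).1 → (w k).2 = (w' k).2

/-- The assumption `A` is sufficient for the specification `L` and the scenario `S`. -/
def SufficientFor (A L S : IOLang I O) : Prop :=
  ∃ σ : Strategy I O, S ⊆ A ∩ σ.Out ∧ A ∩ σ.Out ⊆ L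

/-- `A` is ensurable-optimal for the specification `L` and the scenario `S`: it is ensurable and
sufficient, and no strictly larger ensurable language is sufficient. -/
def EnsurableOptimal (A L S : IOLang I O) : Prop :=
  Ensurable A ∧ SufficientFor A L S ∧
    ∀ B : IOLang I O, Ensurable B → SufficientFor B L S → ¬ A ⊂ B

end Games

/-! ### Parity automata -/

/-- A deterministic parity automaton with set of states `Q`, reading input and output signals.
Its transition relation is `{(s, x, t) | step s x = some t}`; it need not be complete. -/
structure ParityAutomaton (Q I O : Type) where
  start : Q
  step : Q → I ⊕ O → Option Q
  colour : Q → ℕ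

namespace ParityAutomaton

variable {Q I O : Type}

/-- `ρ` is a path from the initial state, labelled by `u`. -/
def IsPath (M : ParityAutomaton Q I O) (ρ : ℕ → Q) (u : ℕ → I ⊕ O) : Prop :=
  ρ 0 = M.start ∧ ∀ n, M.step (ρ n) (u n) = some (ρ (n + 1))

/-- The smallest colour that is seen infinitely often along `ρ` is even. -/
def AcceptingPath (M : ParityAutomaton Q I O) (ρ : ℕ → Q) : Prop :=
  ∃ c, Even c ∧ IsLeast {d | ∀ i, ∃ j ≥ i, M.colour (ρ j) = d} c

/-- The infinite word `u` of signals is accepted. -/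
def Accepts (M : ParityAutomaton Q I O) (u : ℕ → I ⊕ O) : Prop :=
  ∃ ρ, M.IsPath ρ u ∧ M.AcceptingPath ρ

/-- `M` recognises `L ⊆ (Σ_I · Σ_O)^ω`: the infinite words of signals that `M` accepts are exactly
those of `L` (in particular `M` accepts only words in which inputs and outputs alternate). -/
def Recognises (M : ParityAutomaton Q I O) (L : IOLang I O) : Prop :=
  {u | M.Accepts u} = IOWord.letters '' L

/-- The code of a transition: `0` if there is none, and `t + 1` if the next state is `t`. -/
def encodeTarget {n : ℕ} : Option (Fin n) → ℕ
  | none => 0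
  | some t => t + 1

/-- An automaton with states `0, …, n - 1` over the alphabets `{0, …, p - 1}` and `{0, …, q - 1}`,
written down as a list of natural numbers: the number of states, the initial state and then, for
each state, its colour followed by its transition for each input and for each output signal. -/
def encode {n p q : ℕ} (M : ParityAutomaton (Fin n) (Fin p) (Fin q)) : List ℕ :=
  n :: (M.start : ℕ) :: (List.finRange n).flatMap fun s =>
    M.colour s ::
      ((List.finRange p).map fun i => encodeTarget (M.step s (Sum.inl i))) ++
      ((List.finRange q).map fun o => encodeTarget (M.step s (Sum.inr o)))

end ParityAutomaton

/-! ### Size and running time -/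

/-- The size of a list of natural numbers, each written in binary and followed by a separator. -/
def bitSize (l : List ℕ) : ℕ :=
  (l.map fun x => Nat.size x + 1).sum

/-- The program `c`, started on the input `v`, halts with the output `w` after at most `T` steps of
the abstract machine `Turing.ToPartrec.step`, which has lists of natural numbers as its data and
`0`, successor, predecessor (in a case distinction on zero), head, tail and cons as its operations.
One step makes a number of these operations that is bounded in terms of the program only, and
lengthens lists and increases numbers by a bounded amount only. A (multitape) Turing machine on
binary inputs therefore simulates `T` steps in time polynomial in `T` and in the size of the
input: a bound by the exponential of a polynomial in this size is exponential time as usual. -/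
def ComputesInTime (c : Turing.ToPartrec.Code) (v w : List ℕ) (T : ℕ) : Prop :=
  Nonempty (StateTransition.EvalsToInTime Turing.ToPartrec.step
    (Turing.ToPartrec.stepNormal c Turing.ToPartrec.Cont.halt v)
    (some (Turing.ToPartrec.Cfg.halt w)) T)

end Synthesis

/-!
For a strategy `σ` of the controller, the language `assumption σ L` consists of the outcomes of `σ`
in `L` and of all the words that differ from such an outcome for the first time in an output. It is
ensurable, since the environment can repeat the inputs of an outcome as long as the controller
repeats its outputs, and its outcomes of `σ` are in `L`. It is moreover optimal if `σ` respects the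
scenario, keeps some outcome in `L` possible whenever `L` is still possible at all, and, where the
scenario leaves the choice, wins wherever the controller can force `L`
(`ensurableOptimal_assumption`). The reason is that a larger sufficient assumption `B`, with a
strategy `ς` as a witness, can only gain something where `ς` leaves `σ`. The words that go on with
the output of `ς` there belong to `assumption σ L`, hence to `B`, so that `ς` forces `L` there, and
then `σ` does so as well.

Such a `σ` is found in the product of the automata of `L` and `S`: it plays the output that the
scenario requires, if there is one (coherence makes it unique), and otherwise the output of a
positional strategy that wins the parity game where this is possible and cooperates elsewhere
(`ensurableOptimal_controller`). The existence of such a positional strategy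
(`CompleteAutomaton.exists_good`) rests on positional determinacy (`exists_positional`), in the
following form: from every vertex, either one fixed positional strategy wins, or the opponent has a
strategy with memory, here a `Spoiler`. It is proved by freeing the moves vertex by vertex. When
none of the moves at the freed vertex wins, the spoilers against the single moves are shuffled into
one, which resumes the spoiler for the move just made (`Spoiler.shuffle`). The parity condition is
symmetric up to a shift of the colours, so that this also yields positional counterstrategies of the
environment (`CompleteAutomaton.accepting_of_forall_wins`).

The assumption is recognised by a parity automaton of polynomial size: the product of the two
automata, with an accepting sink for the words that leave the outcomes of `σ` while `L` is still
possible (`assumptionAutomaton`). The tests that it depends on (whether `L` or `S` is possible, or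
can be forced, from a state) and the search for the positional strategy only quantify over
positional strategies. These are written as numbers below `q ^ (n + 1)` or `p ^ (n + 1)`, and the
play of two of them is decided after polynomially many steps (`parityAccepting_iterate_iff`). An
exhaustive search therefore takes exponential time.

Running times are controlled by a calculus of numbers that are computable in time polynomial in a
budget (`PolyComputable`), closed under arithmetic, bounded recursion, bounded quantifiers and
bounded search. The output is first assembled as one number, whose digits are the entries of the
list, and then written down (`PolyComputableList.map_range`). For a suitable budget, which is
exponential in a polynomial of the size of the input, all of this applies to the entries of the code
of the automaton (`AutomataPair.polyComputableList_map_entry`, `AutomataPair.budget_le`).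
-/

namespace Synthesis

open Turing.ToPartrec (Code Cont stepNormal stepRet)

/-! ### Running times of programs -/

/-- The program `c` turns the list `v` into the list `w` within `t` steps, whatever remains to be
done afterwards. The final configuration is the one in which `w` has already been handed over to
the continuation, so that running times of composed programs simply add up. -/
def Runs (c : Code) (v w : List ℕ) (t : ℕ) : Prop :=
  ∀ k, ∃ m ≤ t, (flip bind Turing.ToPartrec.step)^[m] (some (stepNormal c k v)) =
    some (stepRet k w)

namespace Runs

variable {c f g : Code} {u v w x : List ℕ} {s t : ℕ}

theorem mono (h : Runs c v w s) (hst : s ≤ t) : Runs c v w t := fun k =>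
  let ⟨m, hm, e⟩ := h k
  ⟨m, hm.trans hst, e⟩

theorem zero' (v : List ℕ) : Runs .zero' v (0 :: v) 1 := fun _ => ⟨1, le_rfl, rfl⟩

theorem succ (v : List ℕ) : Runs .succ v [v.headI + 1] 1 := fun _ => ⟨1, le_rfl, rfl⟩

theorem tail (v : List ℕ) : Runs .tail v v.tail 1 := fun _ => ⟨1, le_rfl, rfl⟩

theorem comp (hg : Runs g u v s) (hf : Runs f v w t) : Runs (.comp f g) u w (s + t) := fun k => by
  obtain ⟨m, hm, e⟩ := hg (.comp f k)
  obtain ⟨m', hm', e'⟩ := hf k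
  refine ⟨m' + m, by omega, ?_⟩
  rw [Function.iterate_add_apply]
  exact (congrArg _ e).trans e'

theorem cons (hf : Runs f u v s) (hg : Runs g u w t) :
    Runs (.cons f g) u (v.headI :: w) (s + t) := fun k => by
  obtain ⟨m, hm, e⟩ := hf (.cons₁ g u k)
  obtain ⟨m', hm', e'⟩ := hg (.cons₂ v k)
  refine ⟨m' + m, by omega, ?_⟩
  rw [Function.iterate_add_apply]
  exact (congrArg _ e).trans e'

theorem case_zero (h : Runs f v w t) : Runs (.case f g) (0 :: v) w t := fun k => h k

theorem case_succ {n : ℕ} (h : Runs g (n :: v) w t) : Runs (.case f g) ((n + 1) :: v) w t :=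
  fun k => h k

theorem fix_exit (h : Runs f v (0 :: w) t) : Runs (.fix f) v w t := fun k => by
  obtain ⟨m, hm, e⟩ := h (.fix f k)
  exact ⟨m, hm, e⟩

theorem fix_step {n : ℕ} (h : Runs f u ((n + 1) :: v) s) (h' : Runs (.fix f) v w t) :
    Runs (.fix f) u w (s + t) := fun k => by
  obtain ⟨m, hm, e⟩ := h (.fix f k)
  obtain ⟨m', hm', e'⟩ := h' k
  refine ⟨m' + m, by omega, ?_⟩
  rw [Function.iterate_add_apply]
  exact (congrArg _ e).trans e'

theorem id (v : List ℕ) : Runs .id v v 2 := (zero' v).comp (tail _)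

theorem nil (v : List ℕ) : Runs .nil v [] 2 := (succ v).comp (tail _)

theorem head (v : List ℕ) : Runs .head v [v.headI] 4 := (id v).cons (nil v)

theorem zero (v : List ℕ) : Runs .zero v [0] 3 := (zero' v).cons (nil v)

theorem computesInTime (h : Runs c v w t) : ComputesInTime c v w t :=
  let ⟨m, hm, e⟩ := h .halt
  ⟨⟨⟨m, e⟩, hm⟩⟩

end Runs

/-! ### Polynomially bounded computations in a context -/

/-- A context is a type of data that are presented to programs as lists of numbers, with a budget
for every datum: bounds on values and running times are polynomials in the budget. -/
class Context (γ : Type) where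
  /-- The list of numbers that presents a datum. -/
  enc : γ → List ℕ
  /-- The quantity in terms of which values and running times are bounded. -/
  budget : γ → ℕ

open Context

/-- The extension of a context by one more number. -/
instance {γ : Type} [Context γ] : Context (γ × ℕ) where
  enc x := x.2 :: enc x.1
  budget x := budget x.1 + x.2

/-- `f` is bounded by a polynomial in the budget. -/
def PolyBdd {γ : Type} [Context γ] (f : γ → ℕ) : Prop :=
  ∃ κ : ℕ, ∀ g, f g ≤ (budget g + 2) ^ κ

namespace PolyBdd

variable {γ δ : Type} [Context γ] [Context δ] {a b : γ → ℕ}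

theorem mono (hb : PolyBdd b) (h : ∀ g, a g ≤ b g) : PolyBdd a :=
  let ⟨κ, hκ⟩ := hb
  ⟨κ, fun g => (h g).trans (hκ g)⟩

theorem budget : PolyBdd (budget : γ → ℕ) := ⟨1, fun g => by simp⟩

theorem const (n : ℕ) : PolyBdd fun _ : γ => n :=
  ⟨n, fun g => (Nat.lt_pow_self (by omega)).le⟩

theorem mul (ha : PolyBdd a) (hb : PolyBdd b) : PolyBdd fun g => a g * b g := by
  obtain ⟨k, hk⟩ := ha
  obtain ⟨l, hl⟩ := hb
  exact ⟨k + l, fun g => by rw [pow_add]; exact Nat.mul_le_mul (hk g) (hl g)⟩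

theorem add (ha : PolyBdd a) (hb : PolyBdd b) : PolyBdd fun g => a g + b g := by
  obtain ⟨k, hk⟩ := ha
  obtain ⟨l, hl⟩ := hb
  refine ⟨k + l + 1, fun g => ?_⟩
  have h1 : 1 ≤ (Context.budget g + 2) ^ k := Nat.one_le_pow _ _ (by omega)
  have h2 : 1 ≤ (Context.budget g + 2) ^ l := Nat.one_le_pow _ _ (by omega)
  have h3 := hk g
  have h4 := hl g
  rw [pow_succ, pow_add]
  calc a g + b g ≤ (Context.budget g + 2) ^ k + (Context.budget g + 2) ^ l := by omega
    _ ≤ (Context.budget g + 2) ^ k * (Context.budget g + 2) ^ l * 2 := by nlinarith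
    _ ≤ _ := Nat.mul_le_mul_left _ (by omega)

theorem pow (ha : PolyBdd a) (n : ℕ) : PolyBdd fun g => a g ^ n := by
  obtain ⟨k, hk⟩ := ha
  exact ⟨k * n, fun g => by rw [pow_mul]; exact Nat.pow_le_pow_left (hk g) n⟩

theorem comp {f : δ → ℕ} (hf : PolyBdd f) {h : γ → δ}
    (hh : PolyBdd fun g => Context.budget (h g)) : PolyBdd fun g => f (h g) := by
  obtain ⟨k, hk⟩ := hf
  exact mono ((hh.add (const 2)).pow k) fun g => hk (h g)

end PolyBdd

/-- A list that some program computes from a datum in a time bounded by a polynomial in the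
budget. -/
def PolyComputableList {γ : Type} [Context γ] (F : γ → List ℕ) : Prop :=
  ∃ (c : Code) (t : γ → ℕ), PolyBdd t ∧ ∀ g, Runs c (enc g) (F g) (t g)

/-- A number that is bounded by a polynomial in the budget and that some program computes from a
datum in a time bounded by such a polynomial. -/
def PolyComputable {γ : Type} [Context γ] (f : γ → ℕ) : Prop :=
  PolyBdd f ∧ PolyComputableList fun g => [f g]

theorem PolyComputableList.cons {γ : Type} [Context γ] {f : γ → ℕ} {F : γ → List ℕ}
    (hf : PolyComputableList fun g => [f g]) (hF : PolyComputableList F) :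
    PolyComputableList fun g => f g :: F g := by
  obtain ⟨c, t, ht, hc⟩ := hf
  obtain ⟨c', t', ht', hc'⟩ := hF
  exact ⟨_, _, ht.add ht', fun g => (hc g).cons (hc' g)⟩

theorem PolyComputableList.enc {γ : Type} [Context γ] : PolyComputableList (enc : γ → List ℕ) :=
  ⟨_, _, .const 2, fun _ => .id _⟩

theorem PolyComputableList.comp {γ δ : Type} [Context γ] [Context δ] {F : δ → List ℕ}
    (hF : PolyComputableList F) {h : γ → δ} (hh : PolyComputableList fun g => Context.enc (h g))
    (hb : PolyBdd fun g => budget (h g)) : PolyComputableList fun g => F (h g) := by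
  obtain ⟨c, t, ht, hc⟩ := hF
  obtain ⟨c', t', ht', hc'⟩ := hh
  exact ⟨_, _, ht'.add (ht.comp hb), fun g => (hc' g).comp (hc (h g))⟩

namespace PolyComputable

variable {γ δ : Type} [Context γ] [Context δ] {a b : γ → ℕ}

theorem comp {f : δ → ℕ} (hf : PolyComputable f) {h : γ → δ}
    (hh : PolyComputableList fun g => enc (h g)) (hb : PolyBdd fun g => budget (h g)) :
    PolyComputable fun g => f (h g) :=
  ⟨hf.1.comp hb, hf.2.comp hh hb⟩

/-- Substitution of a number for the last variable. -/
theorem subst {f : γ × ℕ → ℕ} (hf : PolyComputable f) (ha : PolyComputable a) :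
    PolyComputable fun g => f (g, a g) :=
  hf.comp (h := fun g => (g, a g)) (ha.2.cons .enc) (PolyBdd.budget.add ha.1)

/-- Weakening by one more variable. -/
theorem weaken (ha : PolyComputable a) : PolyComputable fun x : γ × ℕ => a x.1 :=
  ha.comp (h := Prod.fst) ⟨_, _, .const 1, fun _ => .tail _⟩
    (PolyBdd.budget.mono fun _ => Nat.le_add_right _ _)

/-- The last variable. -/
theorem var : PolyComputable fun x : γ × ℕ => x.2 :=
  ⟨PolyBdd.budget.mono fun _ => Nat.le_add_left _ _, _, _, .const 4, fun _ => .head _⟩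

theorem succ (ha : PolyComputable a) : PolyComputable fun g => a g + 1 := by
  obtain ⟨hb, c, t, ht, hc⟩ := ha
  exact ⟨hb.add (.const 1), _, _, ht.add (.const 1), fun g => (hc g).comp (.succ _)⟩

theorem const (n : ℕ) : PolyComputable fun _ : γ => n := by
  induction n with
  | zero => exact ⟨.const 0, _, _, .const 3, fun _ => .zero _⟩
  | succ n ih => exact ih.succ

theorem ite_zero {d : γ → ℕ} (hd : PolyComputable d) (ha : PolyComputable a)
    (hb : PolyComputable b) :
    PolyComputable fun g => if d g = 0 then a g else b g := by
  refine ⟨(ha.1.add hb.1).mono fun g => by split_ifs <;> omega, ?_⟩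
  obtain ⟨-, c, t, ht, hc⟩ := hd
  obtain ⟨-, c₁, t₁, ht₁, hc₁⟩ := ha
  obtain ⟨-, c₂, t₂, ht₂, hc₂⟩ := hb
  refine ⟨.comp (.case c₁ (.comp c₂ .tail)) (.cons c .id), _,
    ((ht.add (.const 2)).add (ht₁.add ((PolyBdd.const 1).add ht₂))), fun g => ?_⟩
  refine ((hc g).cons (.id _)).comp ?_
  simp only [List.headI_cons]
  cases h : d g with
  | zero => exact ((hc₁ g).case_zero).mono (by omega)
  | succ n =>
    exact (Runs.case_succ ((Runs.tail (n :: enc g)).comp (hc₂ g))).mono (by simp)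

/-- Primitive recursion, provided that all the intermediate values obey a polynomial bound. -/
theorem natRec {n z B : γ → ℕ} {s : (γ × ℕ) × ℕ → ℕ} (hn : PolyComputable n) (hz : PolyComputable z)
    (hs : PolyComputable s) (hB : PolyBdd B)
    (h : ∀ g, ∀ i ≤ n g, Nat.rec (motive := fun _ => ℕ) (z g) (fun i r => s ((g, i), r)) i ≤ B g) :
    PolyComputable fun g =>
      Nat.rec (motive := fun _ => ℕ) (z g) (fun i r => s ((g, i), r)) (n g) := by
  refine ⟨hB.mono fun g => h g _ le_rfl, ?_⟩
  obtain ⟨hnb, cn, tn, htn, hcn⟩ := hn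
  obtain ⟨-, cz, tz, htz, hcz⟩ := hz
  obtain ⟨-, cs, ts, ⟨κ, hκ⟩, hcs⟩ := hs
  set R : γ → ℕ → ℕ := fun g i =>
    Nat.rec (motive := fun _ => ℕ) (z g) (fun i r => s ((g, i), r)) i with hR
  -- The state of the loop is a countdown, the current value, the index and the datum.
  let body : Code := .case (.cons .zero (.cons .head .nil))
    (.cons (.comp .succ .zero) (.cons .head (.cons (.comp cs .tail)
      (.cons (.comp .succ (.comp .head (.comp .tail .tail))) (.comp .tail (.comp .tail .tail))))))
  let τ : γ → ℕ := fun g => (budget g + n g + B g + 2) ^ κ + 30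
  have leave : ∀ g i, Runs body (0 :: R g i :: i :: enc g) [0, R g i] 30 := fun g i =>
    (Runs.case_zero ((Runs.zero _).cons ((Runs.head _).cons (Runs.nil _)))).mono (by omega)
  have step : ∀ g i k, i + k + 1 = n g → Runs body ((k + 1) :: R g i :: i :: enc g)
      (1 :: k :: R g (i + 1) :: (i + 1) :: enc g) (τ g) := fun g i k hik => by
    have h1 : ts ((g, i), R g i) ≤ (budget g + n g + B g + 2) ^ κ :=
      (hκ _).trans (Nat.pow_le_pow_left (by
        have := h g i (by omega)
        change budget g + i + R g i + 2 ≤ _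
        simp only [hR]; omega) κ)
    have h2 := hcs ((g, i), R g i)
    have key := Runs.case_succ (f := .cons .zero (.cons .head .nil)) (n := k)
      (v := R g i :: i :: enc g)
      (((Runs.zero _).comp (Runs.succ _)).cons ((Runs.head _).cons
        (((Runs.tail (k :: R g i :: i :: enc g)).comp h2).cons
        (((((Runs.tail _).comp (Runs.tail _)).comp (Runs.head _)).comp (Runs.succ _)).cons
          (((Runs.tail _).comp (Runs.tail _)).comp (Runs.tail _))))))
    exact key.mono (by simp only [τ]; omega)
  have loop : ∀ g k i, i + k = n g →
      Runs (.fix body) (k :: R g i :: i :: enc g) [R g (n g)] (k * τ g + 30) := by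
    intro g k
    induction k with
    | zero =>
      intro i hi
      obtain rfl : i = n g := by omega
      exact ((leave g (n g)).fix_exit).mono (by omega)
    | succ k ih =>
      intro i hik
      exact ((step g i k (by omega)).fix_step (ih (i + 1) (by omega))).mono
        (by rw [Nat.succ_mul]; omega)
  refine ⟨.comp (.fix body) (.cons cn (.cons cz (.cons .zero .id))),
    fun g => (tn g + (tz g + (3 + 2))) + (n g * τ g + 30), ?_, fun g => ?_⟩
  · have hτ : PolyBdd τ :=
      ((((PolyBdd.budget.add hnb).add hB).add (.const 2)).pow κ).add (.const 30)
    exact (htn.add (htz.add (.const _))).add ((hnb.mul hτ).add (.const _))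
  · exact ((hcn g).cons ((hcz g).cons ((Runs.zero _).cons (Runs.id _)))).comp
      (loop g (n g) 0 (by omega))

end PolyComputable

/-! ### Arithmetic, bounded quantifiers and bounded search -/

/-- A property of data that can be tested in a time bounded by a polynomial in the budget. -/
def PolyDecidable {γ : Type} [Context γ] (P : γ → Prop) : Prop :=
  ∃ d : γ → ℕ, PolyComputable d ∧ ∀ g, P g ↔ d g ≠ 0

open Classical in
/-- The last `i < n` with the property `P`, or `0` if there is none. -/
noncomputable def lastSat (P : ℕ → Prop) (n : ℕ) : ℕ :=
  Nat.rec 0 (fun i r => if P i then i else r) n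

theorem lastSat_succ (P : ℕ → Prop) (n : ℕ) [Decidable (P n)] :
    lastSat P (n + 1) = if P n then n else lastSat P n := by
  simp only [lastSat]
  congr

theorem lastSat_le (P : ℕ → Prop) (n : ℕ) : lastSat P n ≤ n := by
  induction n with
  | zero => exact le_rfl
  | succ n ih =>
    classical
    rw [lastSat_succ]
    split_ifs <;> omega

theorem lastSat_lt (P : ℕ → Prop) {n : ℕ} (hn : 0 < n) : lastSat P n < n := by
  cases n with
  | zero => omega
  | succ n =>
    classical
    rw [lastSat_succ]
    have := lastSat_le P n
    split_ifs <;> omega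

theorem lastSat_spec {P : ℕ → Prop} {n : ℕ} (h : ∃ i < n, P i) : P (lastSat P n) := by
  induction n with
  | zero => obtain ⟨i, hi, -⟩ := h; omega
  | succ n ih =>
    classical
    rw [lastSat_succ]
    split_ifs with hn
    · exact hn
    · obtain ⟨i, hi, hPi⟩ := h
      exact ih ⟨i, by rcases Nat.lt_succ_iff_lt_or_eq.1 hi with h | rfl; exacts [h, absurd hPi hn],
        hPi⟩

namespace PolyComputable

variable {γ : Type} [Context γ] {a b : γ → ℕ}

theorem congr {f : γ → ℕ} (hf : PolyComputable f) (h : ∀ g, f g = a g) : PolyComputable a :=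
  (funext h : f = a) ▸ hf

theorem add (ha : PolyComputable a) (hb : PolyComputable b) :
    PolyComputable fun g => a g + b g := by
  have e : ∀ g i, Nat.rec (motive := fun _ => ℕ) (a g) (fun _ r => r + 1) i = a g + i :=
    fun g i => by induction i with
      | zero => rfl
      | succ i ih => simp only [ih]; omega
  exact (natRec (s := fun x => x.2 + 1) hb ha var.succ (ha.1.add hb.1)
    fun g i hi => by simp only [e]; omega).congr fun g => e g _

theorem pred (ha : PolyComputable a) : PolyComputable fun g => a g - 1 := by
  have e : ∀ i, Nat.rec (motive := fun _ => ℕ) 0 (fun i _ => i) i = i - 1 :=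
    fun i => by cases i <;> rfl
  exact (natRec (s := fun x => x.1.2) ha (const 0) var.weaken ha.1
    fun g i hi => by simp only [e]; omega).congr fun g => e _

theorem sub (ha : PolyComputable a) (hb : PolyComputable b) :
    PolyComputable fun g => a g - b g := by
  have e : ∀ g i, Nat.rec (motive := fun _ => ℕ) (a g) (fun _ r => r - 1) i = a g - i :=
    fun g i => by induction i with
      | zero => rfl
      | succ i ih => simp only [ih]; omega
  exact (natRec (s := fun x => x.2 - 1) hb ha var.pred ha.1
    fun g i hi => by simp only [e]; omega).congr fun g => e g _

theorem mul (ha : PolyComputable a) (hb : PolyComputable b) :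
    PolyComputable fun g => a g * b g := by
  have e : ∀ g i, Nat.rec (motive := fun _ => ℕ) 0 (fun _ r => r + a g) i = a g * i :=
    fun g i => by induction i with
      | zero => rfl
      | succ i ih => simp only [ih]; rw [Nat.mul_succ]
  exact (natRec (s := fun x => x.2 + a x.1.1) hb (const 0) (var.add ha.weaken.weaken)
    (ha.1.mul hb.1) fun g i hi => by simp only [e]; exact Nat.mul_le_mul_left _ hi).congr
    fun g => e g _

theorem ite {P : γ → Prop} [∀ g, Decidable (P g)] (hP : PolyDecidable P) (ha : PolyComputable a)
    (hb : PolyComputable b) : PolyComputable fun g => if P g then a g else b g := by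
  obtain ⟨d, hd, h⟩ := hP
  exact (ite_zero hd hb ha).congr fun g => by
    by_cases hg : d g = 0
    · rw [if_pos hg, if_neg (fun hp => (h g).1 hp hg)]
    · rw [if_neg hg, if_pos ((h g).2 hg)]

end PolyComputable

namespace PolyDecidable

variable {γ : Type} [Context γ] {a b : γ → ℕ} {P Q : γ → Prop}

open PolyComputable

theorem congr (hP : PolyDecidable P) (h : ∀ g, P g ↔ Q g) : PolyDecidable Q :=
  (funext fun g => propext (h g) : P = Q) ▸ hP

theorem not (hP : PolyDecidable P) : PolyDecidable fun g => ¬ P g := by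
  obtain ⟨d, hd, h⟩ := hP
  exact ⟨_, (const 1).sub hd, fun g => by have := h g; simp only [this]; omega⟩

theorem and (hP : PolyDecidable P) (hQ : PolyDecidable Q) : PolyDecidable fun g => P g ∧ Q g := by
  obtain ⟨d, hd, h⟩ := hP
  obtain ⟨d', hd', h'⟩ := hQ
  exact ⟨_, hd.mul hd', fun g => by
    simp only [h, h', ne_eq, Nat.mul_eq_zero, not_or]⟩

theorem imp (hP : PolyDecidable P) (hQ : PolyDecidable Q) : PolyDecidable fun g => P g → Q g :=
  (hP.and hQ.not).not.congr fun g => by tauto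

theorem le (ha : PolyComputable a) (hb : PolyComputable b) : PolyDecidable fun g => a g ≤ b g :=
  ⟨_, hb.succ.sub ha, fun g => by omega⟩

theorem lt (ha : PolyComputable a) (hb : PolyComputable b) : PolyDecidable fun g => a g < b g :=
  ⟨_, hb.sub ha, fun g => by omega⟩

theorem eq (ha : PolyComputable a) (hb : PolyComputable b) : PolyDecidable fun g => a g = b g :=
  ((le ha hb).and (le hb ha)).congr fun g => by omega

theorem weaken (hP : PolyDecidable P) : PolyDecidable fun x : γ × ℕ => P x.1 :=
  let ⟨_, hd, h⟩ := hP
  ⟨_, hd.weaken, fun x => h x.1⟩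

theorem exists_lt {P : γ → ℕ → Prop} {n : γ → ℕ} (hP : PolyDecidable fun x : γ × ℕ => P x.1 x.2)
    (hn : PolyComputable n) : PolyDecidable fun g => ∃ i < n g, P g i := by
  classical
  have hite := ite hP.weaken (const 1) (var (γ := γ × ℕ))
  have e : ∀ g i, Nat.rec (motive := fun _ => ℕ) 0 (fun i r => if P g i then 1 else r) i =
      if ∃ j < i, P g j then 1 else 0 := fun g i => by
    induction i with
    | zero => simp
    | succ i ih =>
      simp only [ih, Nat.lt_succ_iff_lt_or_eq, or_and_right, exists_or, exists_eq_left]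
      by_cases h : P g i <;> simp [h]
  refine ⟨_, natRec (s := fun x => if P x.1.1 x.1.2 then 1 else x.2) hn (const 0) hite (.const 1)
    fun g i hi => by simp only [e]; split_ifs <;> omega, fun g => ?_⟩
  simp only [e]
  split_ifs with h <;> simp [h]

theorem forall_lt {P : γ → ℕ → Prop} {n : γ → ℕ} (hP : PolyDecidable fun x : γ × ℕ => P x.1 x.2)
    (hn : PolyComputable n) : PolyDecidable fun g => ∀ i < n g, P g i :=
  (exists_lt (P := fun g i => ¬ P g i) hP.not hn).not.congr fun g => by
    push Not; rfl

end PolyDecidable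

namespace PolyComputable

variable {γ : Type} [Context γ] {a b : γ → ℕ}

theorem lastSat {P : γ → ℕ → Prop} (hP : PolyDecidable fun x : γ × ℕ => P x.1 x.2)
    (ha : PolyComputable a) : PolyComputable fun g => lastSat (P g) (a g) := by
  classical
  have e : ∀ g i, Nat.rec (motive := fun _ => ℕ) 0 (fun i r => if P g i then i else r) i =
      Synthesis.lastSat (P g) i := fun g i => by
    simp only [Synthesis.lastSat]
  exact (natRec (s := fun x => if P x.1.1 x.1.2 then x.1.2 else x.2) ha (const 0)
    (ite hP.weaken var.weaken var) ha.1 fun g i hi => by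
      simp only [e]; exact (lastSat_le _ _).trans hi).congr fun g => e g _

theorem div (ha : PolyComputable a) (hb : PolyComputable b) :
    PolyComputable fun g => a g / b g := by
  refine (ite (.eq hb (const 0)) (const 0) (lastSat (P := fun g i => i * b g ≤ a g)
    (.le (var.mul hb.weaken) ha.weaken) ha.succ)).congr fun g => ?_
  split_ifs with h0
  · rw [h0, Nat.div_zero]
  have h1 : Synthesis.lastSat (fun i => i * b g ≤ a g) (a g + 1) * b g ≤ a g :=
    lastSat_spec (P := fun i => i * b g ≤ a g) ⟨0, by omega, by simp⟩
  have hmax : ∀ n i, i < n → i * b g ≤ a g →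
      i ≤ Synthesis.lastSat (fun i => i * b g ≤ a g) n := fun n => by
    induction n with
    | zero => intro i hi; omega
    | succ n ih =>
      intro i hi hle
      rw [lastSat_succ]
      split_ifs with h
      · omega
      · refine ih i ?_ hle
        rcases Nat.lt_succ_iff_lt_or_eq.1 hi with h' | rfl
        exacts [h', absurd hle h]
  refine le_antisymm ((Nat.le_div_iff_mul_le (by omega)).2 h1)
    (hmax _ _ ?_ (Nat.div_mul_le_self _ _))
  exact Nat.lt_succ_of_le (Nat.div_le_self _ _)

theorem mod (ha : PolyComputable a) (hb : PolyComputable b) :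
    PolyComputable fun g => a g % b g :=
  (ha.sub (hb.mul (ha.div hb))).congr fun g => by
    have := Nat.div_add_mod (a g) (b g)
    omega

theorem sum {e : γ → ℕ → ℕ} (he : PolyComputable fun x : γ × ℕ => e x.1 x.2)
    (ha : PolyComputable a) : PolyComputable fun g => ∑ i ∈ Finset.range (a g), e g i := by
  have hr : ∀ g i, Nat.rec (motive := fun _ => ℕ) 0 (fun i r => r + e g i) i =
      ∑ j ∈ Finset.range i, e g j := fun g i => by
    induction i with
    | zero => rfl
    | succ i ih => rw [Finset.sum_range_succ, ← ih]
  obtain ⟨κ, hκ⟩ := he.1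
  refine (natRec (s := fun x => x.2 + e x.1.1 x.1.2) ha (const 0) (var.add he.weaken)
    (ha.1.mul (((PolyBdd.budget.add ha.1).add (.const 2)).pow κ)) fun g i hi => ?_).congr
    fun g => hr g _
  simp only [hr]
  refine (Finset.sum_le_card_nsmul _ _ ((budget g + a g + 2) ^ κ) fun j hj => ?_).trans ?_
  · refine (hκ (g, j)).trans (Nat.pow_le_pow_left ?_ κ)
    have := Finset.mem_range.1 hj
    change budget g + j + 2 ≤ _
    omega
  · rw [Finset.card_range, smul_eq_mul]
    exact Nat.mul_le_mul_right _ hi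

end PolyComputable

/-! ### Input and output of lists -/

/-- The entries of a list that depends on the datum are computable from their index, and they obey a
common polynomial bound. -/
def Readable {γ : Type} [Context γ] (v : γ → List ℕ) : Prop :=
  (PolyComputable fun x : γ × ℕ => (v x.1).getI x.2) ∧
    ∃ B : γ → ℕ, PolyBdd B ∧ ∀ g i, (v g).getI i ≤ B g

namespace Readable

variable {γ : Type} [Context γ] {v : γ → List ℕ}

theorem getI (hv : Readable v) {i : γ → ℕ} (hi : PolyComputable i) :
    PolyComputable fun g => (v g).getI (i g) :=
  hv.1.subst hi

theorem weaken (hv : Readable v) : Readable fun x : γ × ℕ => v x.1 := by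
  obtain ⟨hv, B, hB, hvB⟩ := hv
  refine ⟨hv.comp (h := fun x : (γ × ℕ) × ℕ => (x.1.1, x.2)) ?_ ?_,
    _, hB.comp (h := fun x : γ × ℕ => x.1)
      (PolyBdd.budget.mono fun _ => Nat.le_add_right _ _), fun x => hvB x.1⟩
  · exact (PolyComputable.var.2).cons
      ⟨_, _, .const (1 + 1), fun x => (Runs.tail (enc x)).comp (.tail _)⟩
  · exact PolyBdd.budget.mono fun x => by
      change budget x.1.1 + x.2 ≤ budget x.1.1 + x.1.2 + x.2
      omega

/-- The presentation of the datum is readable, since a loop can drop its first entries. -/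
theorem enc (h : ∀ g : γ, ∀ x ∈ enc g, x ≤ budget g) : Readable (enc : γ → List ℕ) := by
  have hle : ∀ (g : γ) (i : ℕ), (Context.enc g).getI i ≤ budget g := fun g i => by
    rcases lt_or_ge i (Context.enc g).length with hi | hi
    · rw [List.getI_eq_getElem _ hi]
      exact h _ _ (List.getElem_mem hi)
    · rw [List.getI_eq_default _ hi]
      exact Nat.zero_le _
  refine ⟨⟨PolyBdd.budget.mono fun x => (hle x.1 x.2).trans (Nat.le_add_right _ _), ?_⟩,
    budget, .budget, hle⟩
  let body : Code := .case (.cons .zero .head) (.cons (.comp .succ .zero)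
    (.cons .head (.comp .tail .tail)))
  have loop : ∀ i (w : List ℕ), Runs (.fix body) (i :: w) [w.getI i] (i * 20 + 20) := by
    intro i
    induction i with
    | zero =>
      intro w
      have h1 : Runs body (0 :: w) (0 :: [w.headI]) (3 + 4) :=
        Runs.case_zero ((Runs.zero _).cons (Runs.head _))
      have h2 : w.getI 0 = w.headI := by cases w <;> rfl
      rw [h2]
      exact h1.fix_exit.mono (by omega)
    | succ i ih =>
      intro w
      have h1 := Runs.case_succ (f := .cons .zero .head) (n := i) (v := w)
        (((Runs.zero (i :: w)).comp (.succ _)).cons ((Runs.head (i :: w)).cons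
          ((Runs.tail (i :: w)).comp (.tail _))))
      have h2 : w.getI (i + 1) = w.tail.getI i := by cases w <;> simp
      rw [h2]
      exact (h1.fix_step (ih w.tail)).mono (by omega)
  refine ⟨_, fun x => x.2 * 20 + 20, ?_, fun x => loop x.2 _⟩
  exact ((PolyComputable.var.1.mul (.const 20)).add (.const 20))

end Readable

/-- Any list of numbers, as a context without budget. It serves as the unbounded part of the data of
a loop: the list being written is never read by the loop, so that it costs nothing. -/
instance : Context (List ℕ) where
  enc := id
  budget _ := 0

/-- The last `n` digits of `x` in base `B`, followed by the list `l`. -/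
def digitsAppend (B : ℕ) : ℕ → ℕ → List ℕ → List ℕ
  | 0, _, l => l
  | n + 1, x, l => digitsAppend B n (x / B) (x % B :: l)

theorem digitsAppend_rec (e : ℕ → ℕ) {B n : ℕ} (h : ∀ i < n, e i < B) (l : List ℕ) :
    digitsAppend B n (Nat.rec (motive := fun _ => ℕ) 0 (fun i x => x * B + e i) n) l =
      (List.range n).map e ++ l := by
  induction n generalizing l with
  | zero => rfl
  | succ n ih =>
    have hn := h n (by omega)
    rw [digitsAppend]
    simp only
    rw [Nat.mul_comm, Nat.mul_add_mod, Nat.mod_eq_of_lt hn, Nat.mul_add_div (by omega),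
      Nat.div_eq_of_lt hn, Nat.add_zero, ih fun i hi => h i (by omega), List.range_succ,
      List.map_append, List.append_assoc]
    rfl

/-- A loop writes down the digits of a number. -/
theorem PolyComputableList.digitsAppend {γ : Type} [Context γ] {n x B : γ → ℕ}
    (hn : PolyComputable n) (hx : PolyComputable x) (hB : PolyComputable B) :
    PolyComputableList fun g => digitsAppend (B g) (n g) (x g) [] := by
  -- The data of the loop are the part of the list that is already written, the base, the number
  -- whose digits remain to be written, and the count of these digits.
  let δ : Type := ((List ℕ × ℕ) × ℕ) × ℕ
  have vx : PolyComputable fun d : δ => d.1.2 := PolyComputable.var.weaken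
  have vB : PolyComputable fun d : δ => d.1.1.2 := PolyComputable.var.weaken.weaken
  obtain ⟨-, cd, td, ⟨κ, hκ⟩, hd⟩ := vx.div vB
  obtain ⟨-, cm, tm, ⟨μ, hμ⟩, hm⟩ := vx.mod vB
  let tl3 : Code := .comp .tail (.comp .tail .tail)
  let body : Code := .case (.cons .zero (.comp .tail .tail))
    (.cons (.comp .succ .zero) (.cons .head (.cons cd (.cons (.comp .head (.comp .tail .tail))
      (.cons cm tl3)))))
  let τ : γ → ℕ := fun g =>
    (n g + x g + B g + 2) ^ κ + (n g + x g + B g + 2) ^ μ + 40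
  have loop : ∀ g k y l, k ≤ n g → y ≤ x g →
      Runs (.fix body) (k :: y :: B g :: l) (Synthesis.digitsAppend (B g) k y l)
        (k * τ g + 40) := by
    intro g k
    induction k with
    | zero =>
      intro y l _ _
      have h1 : Runs body (0 :: y :: B g :: l) (0 :: l) (3 + (1 + 1)) :=
        Runs.case_zero ((Runs.zero _).cons ((Runs.tail _).comp (.tail _)))
      exact h1.fix_exit.mono (by omega)
    | succ k ih =>
      intro y l hk hy
      have hb : budget ((((l, B g), y), k) : δ) + 2 ≤ n g + x g + B g + 2 := by
        change 0 + B g + y + k + 2 ≤ _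
        omega
      have h1 := (hκ (((l, B g), y), k)).trans (Nat.pow_le_pow_left hb κ)
      have h2 := (hμ (((l, B g), y), k)).trans (Nat.pow_le_pow_left hb μ)
      have h3 := Runs.case_succ (f := .cons .zero (.comp .tail .tail)) (n := k)
        (v := y :: B g :: l)
        (((Runs.zero _).comp (.succ _)).cons ((Runs.head _).cons ((hd (((l, B g), y), k)).cons
          ((((Runs.tail _).comp (.tail _)).comp (.head _)).cons ((hm (((l, B g), y), k)).cons
            (((Runs.tail _).comp (.tail _)).comp (.tail _)))))))
      refine (h3.fix_step (ih (y / B g) (y % B g :: l) (by omega)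
        ((Nat.div_le_self _ _).trans hy))).mono ?_
      rw [Nat.succ_mul]
      simp only [τ] at *
      omega
  obtain ⟨hnb, cn, tn, htn, hcn⟩ := hn
  obtain ⟨hxb, cx, tx, htx, hcx⟩ := hx
  obtain ⟨hBb, cB, tB, htB, hcB⟩ := hB
  refine ⟨_, fun g => (tn g + (tx g + (tB g + 2))) + (n g * τ g + 40), ?_, fun g =>
    ((hcn g).cons ((hcx g).cons ((hcB g).cons (Runs.nil _)))).comp
      (loop g (n g) (x g) [] le_rfl le_rfl)⟩
  have hs := ((hnb.add hxb).add hBb).add (.const 2)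
  exact (htn.add (htx.add (htB.add (.const 2)))).add
    ((hnb.mul (((hs.pow κ).add (hs.pow μ)).add (.const 40))).add (.const 40))

/-- A list can be computed from its length and its entries, if there is enough budget for the
number of which the entries are the digits. -/
theorem PolyComputableList.map_range {γ : Type} [Context γ] {n D : γ → ℕ} {e : γ → ℕ → ℕ}
    (hn : PolyComputable n) (he : PolyComputable fun x : γ × ℕ => e x.1 x.2) (hD : PolyBdd D)
    (h : ∀ g, (∑ i ∈ Finset.range (n g), e g i + 1) ^ n g ≤ D g) :
    PolyComputableList fun g => (List.range (n g)).map (e g) := by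
  let B : γ → ℕ := fun g => ∑ i ∈ Finset.range (n g), e g i + 1
  have hB : PolyComputable B := (PolyComputable.sum he hn).succ
  have hlt : ∀ g, ∀ i < n g, e g i < B g := fun g i hi =>
    Nat.lt_succ_of_le (Finset.single_le_sum (f := e g) (fun _ _ => Nat.zero_le _)
      (Finset.mem_range.2 hi))
  have hpow : ∀ g, ∀ i ≤ n g,
      Nat.rec (motive := fun _ => ℕ) 0 (fun i x => x * B g + e g i) i < B g ^ i := fun g i => by
    induction i with
    | zero => intro _; simp
    | succ i ih =>
      intro hi
      have h1 := ih (by omega)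
      have h2 := hlt g i (by omega)
      rw [pow_succ]
      simp only
      calc _ < (Nat.rec (motive := fun _ => ℕ) 0 (fun i x => x * B g + e g i) i + 1) * B g := by
            rw [Nat.succ_mul]; omega
        _ ≤ _ := Nat.mul_le_mul_right _ h1
  have hX := PolyComputable.natRec (s := fun x => x.2 * B x.1.1 + e x.1.1 x.1.2) hn
    (PolyComputable.const 0) ((PolyComputable.var.mul hB.weaken.weaken).add he.weaken) hD
    fun g i hi => (hpow g i hi).le.trans ((Nat.pow_le_pow_right (Nat.succ_pos _) hi).trans (h g))
  obtain ⟨c, t, ht, hc⟩ := PolyComputableList.digitsAppend hn hX hB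
  refine ⟨c, t, ht, fun g => ?_⟩
  have := hc g
  simp only at this
  rwa [digitsAppend_rec (e g) (hlt g), List.append_nil] at this

/-! ### The parity condition -/

/-- The smallest colour that occurs infinitely often in the sequence `c` is even. -/
def ParityAccepting (c : ℕ → ℕ) : Prop :=
  ∃ e, Even e ∧ IsLeast {d | ∀ i, ∃ j ≥ i, c j = d} e

theorem parityAccepting_shift (c : ℕ → ℕ) (k : ℕ) :
    ParityAccepting (fun j => c (j + k)) ↔ ParityAccepting c := by
  have : {d | ∀ i, ∃ j ≥ i, c (j + k) = d} = {d | ∀ i, ∃ j ≥ i, c j = d} := by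
    ext d
    constructor
    · intro h i
      obtain ⟨j, hj, e⟩ := h i
      exact ⟨j + k, by omega, e⟩
    · intro h i
      obtain ⟨j, hj, e⟩ := h (i + k)
      exact ⟨j - k, by omega, by rwa [Nat.sub_add_cancel (by omega)]⟩
  simp only [ParityAccepting, this]

theorem ParityAccepting.congr_eventually {c c' : ℕ → ℕ} (h : ParityAccepting c) (k : ℕ)
    (e : ∀ j ≥ k, c j = c' j) : ParityAccepting c' := by
  rw [← parityAccepting_shift c' k]
  rw [← parityAccepting_shift c k] at h
  convert h using 3 with j
  exact (e _ (by omega)).symm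

/-- A predicate that holds infinitely often on times with finitely many labels holds infinitely
often at times with the same label. -/
theorem exists_label_frequently {Γ : Type} [Finite Γ] {P : ℕ → Prop} (lab : ℕ → Γ)
    (h : ∀ i, ∃ j ≥ i, P j) : ∃ γ, ∀ i, ∃ j ≥ i, P j ∧ lab j = γ := by
  by_contra! hc
  choose N hN using hc
  have := Fintype.ofFinite Γ
  obtain ⟨j, hj, hP⟩ := h (Finset.univ.sup N)
  exact hN (lab j) j ((Finset.le_sup (Finset.mem_univ _)).trans hj) hP rfl

/-- If the times of an accepting sequence are distributed to finitely many subsequences, then one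
of them is infinite and accepting. -/
theorem ParityAccepting.exists_label {Γ : Type} [Finite Γ] {c : ℕ → ℕ} (h : ParityAccepting c)
    (lab : ℕ → Γ) : ∃ γ, {t | lab t = γ}.Infinite ∧
      ParityAccepting fun j => c (Nat.nth (fun t => lab t = γ) j) := by
  obtain ⟨e, he, hinf, hmin⟩ := h
  obtain ⟨γ, hγ⟩ := exists_label_frequently lab hinf
  have hI : {t | lab t = γ}.Infinite := Set.infinite_of_not_bddAbove fun ⟨b, hb⟩ => by
    obtain ⟨j, hj, -, h⟩ := hγ (b + 1)
    have := hb h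
    omega
  refine ⟨γ, hI, e, he, fun i => ?_, fun d hd => hmin fun i => ?_⟩
  · obtain ⟨j, hj, h1, h2⟩ := hγ (Nat.nth (fun t => lab t = γ) i)
    classical
    refine ⟨Nat.count (fun t => lab t = γ) j, ?_, ?_⟩
    · exact (Nat.nth_le_nth hI).1 (by rwa [Nat.nth_count (p := fun t => lab t = γ) h2])
    · simp only [Nat.nth_count (p := fun t => lab t = γ) h2, h1]
  · obtain ⟨j, hj, h⟩ := hd i
    exact ⟨_, hj.trans ((Nat.nth_strictMono hI).le_apply), h⟩

/-- The dual of the parity condition is the parity condition for the colours increased by one. -/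
theorem parityAccepting_succ_of_not {W : Type} [Finite W] (col : W → ℕ) (x : ℕ → W)
    (h : ¬ ParityAccepting fun t => col (x t)) : ParityAccepting fun t => col (x t) + 1 := by
  obtain ⟨w, hw⟩ := exists_label_frequently (P := fun _ => True) x fun i => ⟨i, le_rfl, trivial⟩
  have hex : ∃ d, ∀ i, ∃ j ≥ i, col (x j) = d := ⟨col w, fun i => by
    obtain ⟨j, hj, -, e⟩ := hw i
    exact ⟨j, hj, by rw [e]⟩⟩
  classical
  have hmin : ∀ d, (∀ i, ∃ j ≥ i, col (x j) = d) → Nat.find hex ≤ d := fun d hd =>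
    Nat.find_min' hex hd
  refine ⟨Nat.find hex + 1, ?_, fun i => ?_, fun d hd => ?_⟩
  · by_contra hc
    exact h ⟨Nat.find hex, by rwa [Nat.even_add_one, not_not] at hc, Nat.find_spec hex, hmin⟩
  · obtain ⟨j, hj, e⟩ := Nat.find_spec hex i
    exact ⟨j, hj, by simp only [e]⟩
  · have h0 : 0 < d := by
      obtain ⟨j, -, e⟩ := hd 0
      simp only at e
      omega
    have := hmin (d - 1) fun i => by
      obtain ⟨j, hj, e⟩ := hd i
      exact ⟨j, hj, by simp only at e; omega⟩
    omega

theorem not_parityAccepting_succ {c : ℕ → ℕ} (h : ParityAccepting c) :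
    ¬ ParityAccepting fun t => c t + 1 := by
  rintro ⟨e', he', hinf', hmin'⟩
  obtain ⟨e, he, hinf, hmin⟩ := h
  have h1 : e' ≤ e + 1 := hmin' fun i => by
    obtain ⟨j, hj, e⟩ := hinf i
    exact ⟨j, hj, by simp only [e]⟩
  have h0 : 0 < e' := by
    obtain ⟨j, -, e⟩ := hinf' 0
    simp only at e
    omega
  have h2 : e ≤ e' - 1 := hmin fun i => by
    obtain ⟨j, hj, e⟩ := hinf' i
    exact ⟨j, hj, by simp only at e; omega⟩
  obtain rfl : e' = e + 1 := by omega
  exact (Nat.even_add_one.1 he') he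

/-! ### Positional strategies in parity games -/

section Positional

variable {W Γ : Type} (own : W → Prop) (δ : W → Γ → W) (col : W → ℕ)

/-- `x` is a play in which the player who owns the vertices in `own` uses the positional
strategy `f`. -/
def Follows (f : W → Γ) (x : ℕ → W) : Prop :=
  ∀ t, (∃ γ, x (t + 1) = δ (x t) γ) ∧ (own (x t) → x (t + 1) = δ (x t) (f (x t)))

/-- The positional strategy `f` wins from the vertex `u`. -/
def WinsFrom (f : W → Γ) (u : W) : Prop :=
  ∀ x : ℕ → W, x 0 = u → Follows own δ f x → ParityAccepting fun t => col (x t)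

/-- A winning strategy, with memory, of the opponent: a transition graph that answers all moves that
`D` allows the owner of the vertices in `own`, and all of whose paths violate the parity
condition. -/
structure Spoiler (D : W → Γ → Prop) where
  /-- The states of the memory. -/
  M : Type
  /-- The transitions between them. -/
  rel : M → M → Prop
  /-- The vertex of the game at which a play is in a given state of the memory. -/
  pos : M → W
  attack : ∀ m, own (pos m) → ∀ γ, D (pos m) γ → ∃ m', rel m m' ∧ pos m' = δ (pos m) γ
  defend : ∀ m, ¬ own (pos m) → ∃ m', rel m m' ∧ ∃ γ, pos m' = δ (pos m) γ
  bad : ∀ x : ℕ → M, (∀ t, rel (x t) (x (t + 1))) → ¬ ParityAccepting fun t => col (pos (x t))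

variable {own δ col}

/-- A spoiler beats every positional strategy that uses only moves allowed by `D`. -/
theorem Spoiler.not_winsFrom {D : W → Γ → Prop} (P : Spoiler own δ col D) {f : W → Γ}
    (hf : ∀ w, D w (f w)) (m : P.M) : ¬ WinsFrom own δ col f (P.pos m) := by
  have h : ∀ m, ∃ m', P.rel m m' ∧ (∃ γ, P.pos m' = δ (P.pos m) γ) ∧
      (own (P.pos m) → P.pos m' = δ (P.pos m) (f (P.pos m))) := fun m => by
    by_cases hm : own (P.pos m)
    · obtain ⟨m', h1, h2⟩ := P.attack m hm _ (hf _)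
      exact ⟨m', h1, ⟨_, h2⟩, fun _ => h2⟩
    · obtain ⟨m', h1, h2⟩ := P.defend m hm
      exact ⟨m', h1, h2, fun h => absurd h hm⟩
  choose next h1 h2 using h
  intro hw
  refine P.bad (fun t => next^[t] m) (fun t => ?_)
    (hw (fun t => P.pos (next^[t] m)) rfl fun t => ?_)
  · rw [Function.iterate_succ_apply']
    exact h1 _
  · simp only [Function.iterate_succ_apply']
    exact h2 _

/-- Spoilers for all the games in which the move at `v` is fixed combine into a spoiler for the game
in which it is free, if they all cover `v`: the combined strategy keeps one memory state for each
fixed move, and resumes the one that belongs to the move which has been made at `v`. By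
`ParityAccepting.exists_label`, a path that satisfied the parity condition would do so on the part
of it that belongs to one of the given spoilers. -/
def Spoiler.shuffle [Finite Γ] {D : W → Γ → Prop} {v : W} {E : Γ → W → Γ → Prop}
    (P : ∀ γ, Spoiler own δ col (E γ)) (hE : ∀ γ, E γ v γ)
    (hD : ∀ γ w γ', w ≠ v → D w γ' → E γ w γ') :
    Spoiler own δ col D where
  M := {m : Γ × (∀ γ, (P γ).M) // ∀ γ ≠ m.1, (P γ).pos (m.2 γ) = v}
  rel m m' := (m'.1.1 = m.1.1 ∨ (P m.1.1).pos (m.1.2 m.1.1) = v) ∧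
    (P m'.1.1).rel (m.1.2 m'.1.1) (m'.1.2 m'.1.1) ∧ ∀ γ ≠ m'.1.1, m'.1.2 γ = m.1.2 γ
  pos m := (P m.1.1).pos (m.1.2 m.1.1)
  attack := by
    classical
    rintro ⟨⟨c, ms⟩, hm⟩ hown γ hγ
    by_cases hv : (P c).pos (ms c) = v
    · have hall : ∀ γ', (P γ').pos (ms γ') = v := fun γ' => by
        by_cases h : γ' = c
        · rw [h]; exact hv
        · exact hm γ' h
      obtain ⟨m', h1, h2⟩ := (P γ).attack (ms γ)
        (by rw [hall γ]; simp only [hv] at hown; exact hown) γ (by rw [hall γ]; exact hE γ)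
      refine ⟨⟨⟨γ, Function.update ms γ m'⟩, fun γ' h => ?_⟩, ⟨Or.inr hv, ?_, fun γ' h => ?_⟩, ?_⟩
      · simp only [Function.update_of_ne h, hall]
      · simpa using h1
      · exact Function.update_of_ne h _ _
      · simp only [Function.update_self, h2, hall]
    · obtain ⟨m', h1, h2⟩ := (P c).attack (ms c) hown γ (hD _ _ _ hv hγ)
      refine ⟨⟨⟨c, Function.update ms c m'⟩, fun γ' h => ?_⟩, ⟨Or.inl rfl, ?_, fun γ' h => ?_⟩, ?_⟩
      · simp only [Function.update_of_ne h]; exact hm γ' h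
      · simpa using h1
      · exact Function.update_of_ne h _ _
      · simpa using h2
  defend := by
    classical
    rintro ⟨⟨c, ms⟩, hm⟩ hown
    obtain ⟨m', h1, γ, h2⟩ := (P c).defend (ms c) hown
    refine ⟨⟨⟨c, Function.update ms c m'⟩, fun γ' h => ?_⟩, ⟨Or.inl rfl, ?_, fun γ' h => ?_⟩, γ, ?_⟩
    · simp only [Function.update_of_ne h]; exact hm γ' h
    · simpa using h1
    · exact Function.update_of_ne h _ _
    · simpa using h2
  bad := by
    intro x hx hacc
    obtain ⟨γ, hI, hγ⟩ := hacc.exists_label fun t => (x (t + 1)).1.1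
    set s : ℕ → ℕ := Nat.nth fun t => (x (t + 1)).1.1 = γ with hs
    have hlab : ∀ j, (x (s j + 1)).1.1 = γ := fun j => Nat.nth_mem_of_infinite hI j
    -- Between two times with the label `γ`, the memory state for `γ` does not change.
    have hconst : ∀ j k, s j + 1 + k ≤ s (j + 1) →
        (x (s j + 1 + k)).1.2 γ = (x (s j + 1)).1.2 γ := by
      intro j k
      induction k with
      | zero => intro _; rfl
      | succ k ih =>
        intro hk
        rw [← ih (by omega)]
        refine (hx (s j + 1 + k)).2.2 γ fun h => ?_
        classical
        have h1 : s j < s j + 1 + k := by omega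
        have h2 : s j + 1 + k < s (j + 1) := by omega
        have h3 := Nat.nth_count (p := fun t => (x (t + 1)).1.1 = γ) h.symm
        change s _ = _ at h3
        rw [← h3] at h1 h2
        have h4 := (Nat.nth_lt_nth hI).1 h1
        have h5 := (Nat.nth_lt_nth hI).1 h2
        omega
    refine (P γ).bad (fun j => (x (s j)).1.2 γ) (fun j => ?_) ?_
    · have hlt : s j < s (j + 1) := (Nat.nth_lt_nth hI).2 (by omega)
      have h1 := hconst j (s (j + 1) - (s j + 1)) (by omega)
      rw [show s j + 1 + (s (j + 1) - (s j + 1)) = s (j + 1) by omega] at h1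
      simp only [h1]
      have h2 := (hx (s j)).2.1
      rw [hlab j] at h2
      exact h2
    · convert hγ using 3 with j
      by_cases hc : (x (s j)).1.1 = γ
      · rw [hc]
      · have h1 := (hx (s j)).1.resolve_left (by rw [hlab]; exact fun h => hc h.symm)
        rw [h1]
        exact (x (s j)).2 γ (fun h => hc h.symm)

theorem Follows.shift {f : W → Γ} {x : ℕ → W} (h : Follows own δ f x) (k : ℕ) :
    Follows own δ f fun t => x (t + k) := fun t => by
  have := h (t + k)
  rwa [show t + k + 1 = t + 1 + k by omega] at this

variable (own δ col)

/-- Positional determinacy for the player who wants the parity condition to hold, by induction on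
the set `T` of the vertices at which the moves are free; elsewhere `φ` fixes them. -/
theorem exists_positional_of_free [Finite Γ] [Nonempty Γ] [DecidableEq W] (T : Finset W) :
    ∀ φ : W → Γ, ∃ f : W → Γ, (∀ w ∉ T, f w = φ w) ∧
      ∃ P : Spoiler own δ col (fun w γ => w ∈ T ∨ γ = φ w),
        ∀ u, WinsFrom own δ col f u ∨ ∃ m, P.pos m = u := by
  induction T using Finset.induction_on with
  | empty =>
    intro φ
    refine ⟨φ, fun _ _ => rfl, ⟨{x : ℕ → W // Follows own δ φ x ∧
      ¬ ParityAccepting fun t => col (x t)}, fun x x' => x'.1 = fun t => x.1 (t + 1),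
      fun x => x.1 0, ?_, ?_, ?_⟩, fun u => ?_⟩
    · rintro ⟨x, hx, hb⟩ hown γ (h | rfl)
      · simp at h
      · exact ⟨⟨_, hx.shift 1, by rwa [parityAccepting_shift (fun t => col (x t)) 1]⟩, rfl,
          (hx 0).2 hown⟩
    · rintro ⟨x, hx, hb⟩ hown
      exact ⟨⟨_, hx.shift 1, by rwa [parityAccepting_shift (fun t => col (x t)) 1]⟩, rfl,
          (hx 0).1⟩
    · intro x hx hacc
      have : ∀ t, (x t).1 = fun s => (x 0).1 (s + t) := fun t => by
        induction t with
        | zero => rfl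
        | succ t ih => rw [hx t, ih]; funext s; simp only [Nat.add_assoc, Nat.add_comm 1]
      refine (x 0).2.2 ?_
      convert hacc using 3 with t
      simp only [this t, Nat.zero_add]
    · by_cases h : WinsFrom own δ col φ u
      · exact Or.inl h
      · simp only [WinsFrom, not_forall] at h
        obtain ⟨x, h0, hx, hb⟩ := h
        exact Or.inr ⟨⟨x, hx, hb⟩, h0⟩
  | insert v T hv ih =>
    intro φ
    choose f hf P hP using fun γ => ih (Function.update φ v γ)
    have hfv : ∀ γ w, w ∉ insert v T → f γ w = φ w := fun γ w hw => by
      rw [Finset.mem_insert, not_or] at hw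
      rw [hf γ w hw.2, Function.update_of_ne hw.1]
    have hmove : ∀ γ w γ', w ≠ v → w ∈ insert v T ∨ γ' = φ w →
        w ∈ T ∨ γ' = Function.update φ v γ w := fun γ w γ' hw h => by
      rwa [Finset.mem_insert, or_iff_right hw, ← Function.update_of_ne hw γ φ] at h
    by_cases hcase : ∃ γ, WinsFrom own δ col (f γ) v
    · obtain ⟨γ, hγ⟩ := hcase
      -- The spoiler for the game with the move `γ` at `v` avoids `v`, where `f γ` wins.
      have hne : ∀ m, (P γ).pos m ≠ v := fun m h =>
        (P γ).not_winsFrom (fun w => or_iff_not_imp_left.2 (hf γ w)) m (h.symm ▸ hγ)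
      exact ⟨f γ, hfv γ, ⟨(P γ).M, (P γ).rel, (P γ).pos,
        fun m hm γ' h => (P γ).attack m hm γ' (hmove γ _ γ' (hne m) h), (P γ).defend, (P γ).bad⟩,
        hP γ⟩
    · classical
      push Not at hcase
      obtain ⟨γ₀⟩ := ‹Nonempty Γ›
      choose base hbase using fun γ => (hP γ v).resolve_left (hcase γ)
      refine ⟨f γ₀, hfv γ₀, Spoiler.shuffle (v := v) P (fun γ => by simp) hmove, fun u => ?_⟩
      refine (hP γ₀ u).imp_right ?_
      rintro ⟨m, rfl⟩
      refine ⟨⟨⟨γ₀, Function.update base γ₀ m⟩, fun γ h => ?_⟩, ?_⟩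
      · simp only [Function.update_of_ne h, hbase]
      · simp [Spoiler.shuffle]

/-- Positional determinacy: a positional strategy wins from all the vertices from which no spoiler
prevents this. -/
theorem exists_positional [Finite W] [Finite Γ] [Nonempty Γ] :
    ∃ f : W → Γ, ∃ P : Spoiler own δ col (fun _ _ => True),
      ∀ u, WinsFrom own δ col f u ∨ ∃ m, P.pos m = u := by
  classical
  have := Fintype.ofFinite W
  obtain ⟨γ₀⟩ := ‹Nonempty Γ›
  have : Nonempty Γ := ⟨γ₀⟩
  obtain ⟨f, -, P, hP⟩ := exists_positional_of_free own δ col Finset.univ fun _ => γ₀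
  exact ⟨f, ⟨P.M, P.rel, P.pos, fun m hm γ _ => P.attack m hm γ (by simp), P.defend, P.bad⟩, hP⟩

/-- In a one-player game, there is a positional strategy that satisfies the parity condition from
all the vertices from which it can be satisfied. -/
theorem exists_positional_of_path [Finite W] [Finite Γ] [Nonempty Γ] :
    ∃ f : W → Γ, ∀ x : ℕ → W, (∀ t, ∃ γ, x (t + 1) = δ (x t) γ) →
      (ParityAccepting fun t => col (x t)) →
      ParityAccepting fun t => col ((fun w => δ w (f w))^[t] (x 0)) := by
  obtain ⟨f, P, hP⟩ := exists_positional (fun _ => True) δ col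
  refine ⟨f, fun x hx hacc => ?_⟩
  rcases hP (x 0) with h | ⟨m, hm⟩
  · exact h _ rfl fun t =>
      ⟨⟨f _, Function.iterate_succ_apply' _ _ _⟩, fun _ => Function.iterate_succ_apply' _ _ _⟩
  · exfalso
    choose γ hγ using hx
    choose next h1 h2 using fun m γ => P.attack m trivial γ trivial
    let y : ℕ → P.M := fun t => Nat.rec m (fun t m => next m (γ t)) t
    have hy : ∀ t, P.pos (y t) = x t := fun t => by
      induction t with
      | zero => exact hm
      | succ t ih => rw [hγ, ← ih]; exact h2 _ _
    refine P.bad y (fun t => h1 _ _) ?_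
    simpa only [hy] using hacc

/-- The parity condition along the iterates of a map of at most `N` points is decided by the
iterates between `N` and `2 * N`. -/
theorem parityAccepting_iterate_iff [Fintype W] (F : W → W) (u : W) {N : ℕ}
    (hN : Fintype.card W ≤ N) :
    (ParityAccepting fun t => col (F^[t] u)) ↔ ∃ j < 2 * N, N ≤ j ∧ Even (col (F^[j] u)) ∧
      ∀ i < 2 * N, N ≤ i → col (F^[j] u) ≤ col (F^[i] u) := by
  obtain ⟨a, b, hab, hb, he⟩ : ∃ a b, a < b ∧ b ≤ N ∧ F^[a] u = F^[b] u := by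
    obtain ⟨a, b, hne, he⟩ := Fintype.exists_ne_map_eq_of_card_lt
      (fun i : Fin (N + 1) => F^[i.1] u) (by rw [Fintype.card_fin]; omega)
    rcases lt_or_gt_of_ne hne with h | h
    · exact ⟨a, b, h, by omega, he⟩
    · exact ⟨b, a, h, by omega, he.symm⟩
  have hper : ∀ k i, a ≤ i → F^[i + k * (b - a)] u = F^[i] u := by
    intro k
    induction k with
    | zero => intro i _; simp
    | succ k ih =>
      intro i hi
      rw [Nat.succ_mul, show i + (k * (b - a) + (b - a)) = (i + (b - a)) + k * (b - a) by omega,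
        ih _ (by omega), show i + (b - a) = (i - a) + b by omega, Function.iterate_add_apply, ← he,
        ← Function.iterate_add_apply, Nat.sub_add_cancel hi]
  have hred : ∀ i, N ≤ i → ∃ j < 2 * N, N ≤ j ∧ F^[j] u = F^[i] u := fun i hi => by
    refine ⟨N + (i - N) % (b - a), ?_, by omega, ?_⟩
    · have := Nat.mod_lt (i - N) (show 0 < b - a by omega)
      omega
    · rw [← hper ((i - N) / (b - a)) _ (by omega), Nat.add_assoc, Nat.mod_add_div',
        Nat.add_sub_cancel' hi]
  have hinf : ∀ j, N ≤ j → ∀ i, ∃ k ≥ i, F^[k] u = F^[j] u := fun j hj i =>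
    ⟨j + i * (b - a), by
      have := Nat.le_mul_of_pos_right i (show 0 < b - a by omega)
      omega, hper i j (by omega)⟩
  constructor
  · rintro ⟨e, hev, hi, hmin⟩
    obtain ⟨i, hiN, rfl⟩ := hi N
    obtain ⟨j, hj, hjN, e⟩ := hred i hiN
    refine ⟨j, hj, hjN, by rwa [e], fun i' _ hiN' => ?_⟩
    rw [e]
    exact hmin fun k => by
      obtain ⟨k', hk', e'⟩ := hinf i' hiN' k
      exact ⟨k', hk', by simp only [e']⟩
  · rintro ⟨j, hj, hjN, hev, hmin⟩
    refine ⟨_, hev, fun i => ?_, fun d hd => ?_⟩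
    · obtain ⟨k, hk, e⟩ := hinf j hjN i
      exact ⟨k, hk, by simp only [e]⟩
    · obtain ⟨i, hiN, rfl⟩ := hd N
      obtain ⟨i', hi', hiN', e⟩ := hred i hiN
      simp only [← e]
      exact hmin i' hi' hiN'

end Positional

section Languages

variable {I O : Type} {L S : IOLang I O} {σ : Strategy I O} {τ : EnvStrategy I O}

/-! ### Plays -/

theorem IOWord.take_succ (w : IOWord I O) (k : ℕ) : w.take (k + 1) = w.take k ++ [w k] := by
  simp [IOWord.take, List.range_succ]

theorem IOWord.length_take (w : IOWord I O) (k : ℕ) : (w.take k).length = k := by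
  simp [IOWord.take]

theorem IOWord.take_eq_take_iff {w x : IOWord I O} {k : ℕ} :
    w.take k = x.take k ↔ ∀ j < k, w j = x j := by
  simp [IOWord.take]

theorem IOWord.take_eq_of_le {w x : IOWord I O} {j k : ℕ} (h : w.take k = x.take k) (hj : j ≤ k) :
    w.take j = x.take j :=
  take_eq_take_iff.2 fun i hi => take_eq_take_iff.1 h i (hi.trans_le hj)

/-- The two words agree on the first `k` rounds and on the input that follows. -/
def Agree (w x : IOWord I O) (k : ℕ) : Prop :=
  w.take k = x.take k ∧ (w k).1 = (x k).1

theorem Agree.symm {w x : IOWord I O} {k : ℕ} (h : Agree w x k) : Agree x w k :=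
  ⟨h.1.symm, h.2.symm⟩

theorem Agree.trans {w x y : IOWord I O} {k : ℕ} (h : Agree w x k) (h' : Agree x y k) :
    Agree w y k :=
  ⟨h.1.trans h'.1, h.2.trans h'.2⟩

theorem Agree.of_take {w x : IOWord I O} {j k : ℕ} (h : w.take k = x.take k) (hj : j < k) :
    Agree w x j :=
  ⟨IOWord.take_eq_of_le h hj.le, by rw [IOWord.take_eq_take_iff.1 h j hj]⟩

/-- Two outcomes of a strategy of the controller have the same outputs after the same input. -/
theorem Agree.snd_eq {w x : IOWord I O} {k : ℕ} (h : Agree w x k) (hw : w ∈ σ.Out)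
    (hx : x ∈ σ.Out) : (w k).2 = (x k).2 := by
  rw [hw k, hx k, h.1, h.2]

/-- The first rounds of the play in which both players follow the given strategies. -/
def history (σ : Strategy I O) (τ : EnvStrategy I O) : ℕ → List (I × O)
  | 0 => []
  | k + 1 => history σ τ k ++ [(τ (history σ τ k), σ (history σ τ k) (τ (history σ τ k)))]

/-- The play in which both players follow the given strategies. -/
def play (σ : Strategy I O) (τ : EnvStrategy I O) : IOWord I O := fun k =>
  (τ (history σ τ k), σ (history σ τ k) (τ (history σ τ k)))

theorem take_play (σ : Strategy I O) (τ : EnvStrategy I O) (k : ℕ) :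
    (play σ τ).take k = history σ τ k := by
  induction k with
  | zero => rfl
  | succ k ih => rw [IOWord.take_succ, ih]; rfl

theorem play_mem_out (σ : Strategy I O) (τ : EnvStrategy I O) : play σ τ ∈ σ.Out := fun k => by
  rw [take_play]; rfl

theorem play_mem_env_out (σ : Strategy I O) (τ : EnvStrategy I O) : play σ τ ∈ τ.Out := fun k => by
  rw [take_play]; rfl

theorem take_play_eq {w : IOWord I O} {k : ℕ} (h1 : ∀ j < k, (w j).1 = τ (w.take j))
    (h2 : ∀ j < k, (w j).2 = σ (w.take j) (w j).1) : (play σ τ).take k = w.take k := by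
  induction k with
  | zero => rfl
  | succ k ih =>
    have hk := ih (fun j hj => h1 j (by omega)) fun j hj => h2 j (by omega)
    rw [IOWord.take_succ, IOWord.take_succ, hk]
    have e1 : (play σ τ k).1 = (w k).1 := by
      rw [h1 k (by omega), play_mem_env_out σ τ k, hk]
    have e2 : (play σ τ k).2 = (w k).2 := by
      rw [h2 k (by omega), play_mem_out σ τ k, hk, e1]
    rw [Prod.ext e1 e2]

/-- The first round in which an infinite word leaves the outcomes of a strategy of the
controller. -/
theorem exists_first_deviation {w : IOWord I O} (hw : w ∉ σ.Out) :
    ∃ k, (w k).2 ≠ σ (w.take k) (w k).1 ∧ ∀ j < k, (w j).2 = σ (w.take j) (w j).1 := by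
  classical
  have h : ∃ k, (w k).2 ≠ σ (w.take k) (w k).1 := by
    by_contra! h
    exact hw h
  exact ⟨Nat.find h, Nat.find_spec h, fun j hj => not_not.1 (Nat.find_min h hj)⟩

/-- Any finite beginning of a play can be prolonged into an outcome, if it respects the strategy. -/
theorem exists_mem_out_agree {w : IOWord I O} {k : ℕ}
    (h : ∀ j < k, (w j).2 = σ (w.take j) (w j).1) : ∃ x ∈ σ.Out, Agree x w k := by
  refine ⟨play σ fun h => (w h.length).1, play_mem_out _ _, ?_, ?_⟩
  · exact take_play_eq (fun j _ => by rw [IOWord.length_take]) h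
  · rw [play_mem_env_out σ _ k, IOWord.length_take]

/-! ### The assumption that belongs to a strategy of the controller -/

/-- The assumption under which the strategy `σ` satisfies `L`: besides the outcomes in `L`, it
contains all the words that differ from such an outcome for the first time in an output. -/
def assumption (σ : Strategy I O) (L : IOLang I O) : IOLang I O :=
  {w | ∃ x ∈ σ.Out ∩ L, w = x ∨ ∃ k, Agree w x k ∧ (w k).2 ≠ (x k).2}

theorem ensurable_assumption (σ : Strategy I O) (L : IOLang I O) : Ensurable (assumption σ L) := by
  classical
  rintro h ⟨w, ⟨x, hx, hwx⟩, hw⟩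
  -- The environment repeats the inputs of `x` as long as the controller repeats its outputs.
  refine ⟨fun u => if u = x.take u.length then (x u.length).1 else (w u.length).1,
    ⟨w, fun k => ?_, hw⟩, fun v hv => ⟨x, hx, ?_⟩⟩
  · simp only [IOWord.length_take]
    split_ifs with hk
    · rcases hwx with rfl | ⟨j, hj, hne⟩
      · rfl
      · rcases lt_trichotomy k j with h | rfl | h
        · rw [IOWord.take_eq_take_iff.1 hj.1 k h]
        · exact hj.2
        · exact absurd (by rw [IOWord.take_eq_take_iff.1 hk j h]) hne
    · rfl
  · by_cases hvx : v = x
    · exact Or.inl hvx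
    right
    have hex : ∃ k, v k ≠ x k := by
      by_contra! h
      exact hvx (funext h)
    have h0 : v.take (Nat.find hex) = x.take (Nat.find hex) :=
      IOWord.take_eq_take_iff.2 fun j hj => not_not.1 (Nat.find_min hex hj)
    have h1 : (v (Nat.find hex)).1 = (x (Nat.find hex)).1 := by
      rw [hv (Nat.find hex)]
      simp only [IOWord.length_take]
      rw [if_pos h0]
    exact ⟨_, ⟨h0, h1⟩, fun h2 => Nat.find_spec hex (Prod.ext h1 h2)⟩

theorem assumption_inter_out_subset (σ : Strategy I O) (L : IOLang I O) :
    assumption σ L ∩ σ.Out ⊆ L := by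
  rintro w ⟨⟨x, hx, rfl | ⟨k, hk, hne⟩⟩, hw⟩
  · exact hx.2
  · exact absurd (hk.snd_eq hw hx.1) hne

/-- A word belongs to the assumption as soon as every prolongation by `σ` of a beginning of it
belongs to `L`. -/
theorem mem_assumption_of_forall {w : IOWord I O} {k : ℕ}
    (hw : ∀ j < k, (w j).2 = σ (w.take j) (w j).1)
    (h : ∀ x ∈ σ.Out, Agree x w k → x ∈ L) : w ∈ assumption σ L := by
  by_cases hσ : w ∈ σ.Out
  · exact ⟨w, ⟨hσ, h w hσ ⟨rfl, rfl⟩⟩, Or.inl rfl⟩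
  obtain ⟨j, hj, hlt⟩ := exists_first_deviation hσ
  have hkj : k ≤ j := by
    by_contra! hc
    exact hj (hw j hc)
  obtain ⟨x, hx, hxw⟩ := exists_mem_out_agree hlt
  refine ⟨x, ⟨hx, h x hx ?_⟩, Or.inr ⟨j, hxw.symm, ?_⟩⟩
  · rcases hkj.eq_or_lt with rfl | hkj
    · exact hxw
    · exact .of_take hxw.1 hkj
  · rw [hx j, hxw.1, hxw.2]
    exact hj

/-- Sufficient conditions for optimality: `σ` never loses the possibility of an outcome in `L`
(`hcoop`), and it forces `L` wherever this is possible and `S` leaves the choice (`hwin`). -/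
theorem ensurableOptimal_assumption (hSL : S ⊆ L) (hS : S ⊆ σ.Out)
    (hcoop : ∀ x ∈ σ.Out, ∀ w ∈ L, ∀ k, Agree w x k → ∃ y ∈ σ.Out ∩ L, Agree y x k)
    (hwin : ∀ x ∈ σ.Out, ∀ k, (∀ s ∈ S, ¬ Agree s x k) →
      ∀ ς : Strategy I O, (∃ y ∈ ς.Out, Agree y x k) → (∀ w ∈ ς.Out, Agree w x k → w ∈ L) →
        x ∈ L) :
    EnsurableOptimal (assumption σ L) L S := by
  have hLA : L ⊆ assumption σ L := by
    intro w hw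
    by_cases hσ : w ∈ σ.Out
    · exact ⟨w, ⟨hσ, hw⟩, Or.inl rfl⟩
    obtain ⟨k, hk, hlt⟩ := exists_first_deviation hσ
    obtain ⟨x, hx, hxw⟩ := exists_mem_out_agree hlt
    obtain ⟨y, hy, hyx⟩ := hcoop x hx w hw k hxw.symm
    have hyw := hyx.trans hxw
    refine ⟨y, hy, Or.inr ⟨k, hyw.symm, ?_⟩⟩
    rw [hy.1 k, hyw.1, hyw.2]
    exact hk
  refine ⟨ensurable_assumption σ L,
    ⟨σ, fun s hs => ⟨hLA (hSL hs), hS hs⟩, assumption_inter_out_subset σ L⟩, ?_⟩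
  rintro B hB ⟨ς, hSB, hBL⟩ ⟨hAB, hBA⟩
  refine hBA fun v hv => ?_
  by_cases hvς : v ∈ ς.Out
  · exact hLA (hBL ⟨hv, hvς⟩)
  obtain ⟨k, hk, hlt⟩ := exists_first_deviation hvς
  -- Since `B` is ensurable, a word of `L` continues `v` up to this deviation from `ς`.
  obtain ⟨y, hyς, hyB, hyv⟩ : ∃ y ∈ ς.Out, y ∈ B ∧ Agree y v k := by
    obtain ⟨τ, ⟨u, huτ, hu⟩, hτ⟩ := hB (v.take (k + 1)) ⟨v, hv, by
      rw [IOWord.HasPrefix, IOWord.length_take]⟩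
    rw [IOWord.HasPrefix, IOWord.length_take] at hu
    have hτv : ∀ j ≤ k, (v j).1 = τ (v.take j) := fun j hj => by
      rw [← IOWord.take_eq_take_iff.1 hu j (by omega), huτ j,
        IOWord.take_eq_of_le hu (show j ≤ k + 1 by omega)]
    have htake : (play ς τ).take k = v.take k := take_play_eq (fun j hj => hτv j hj.le) hlt
    refine ⟨play ς τ, play_mem_out _ _, hτ (play_mem_env_out _ _), htake, ?_⟩
    rw [play_mem_env_out ς τ k, htake, hτv k le_rfl]
  have hyk : (v k).2 ≠ (y k).2 := by
    rw [hyς k, hyv.1, hyv.2]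
    exact hk
  obtain ⟨x, hx, rfl | ⟨j, hj, hne⟩⟩ := hLA (hBL ⟨hyB, hyς⟩)
  · exact ⟨y, hx, Or.inr ⟨k, hyv.symm, hyk⟩⟩
  rcases lt_trichotomy j k with hjk | rfl | hjk
  · have hvj : Agree v y j := .of_take hyv.1.symm hjk
    refine ⟨x, hx, Or.inr ⟨j, hvj.trans hj, ?_⟩⟩
    rwa [IOWord.take_eq_take_iff.1 hyv.1.symm j hjk]
  · by_cases hvx : (v j).2 = (x j).2
    swap
    · exact ⟨x, hx, Or.inr ⟨j, hyv.symm.trans hj, hvx⟩⟩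
    have hvx' := hyv.symm.trans hj
    -- All the words that go on with the output of `ς` belong to the assumption, hence to `B`:
    -- therefore `ς` forces `L`, and so does `σ`.
    refine mem_assumption_of_forall (k := j) (fun i hi => ?_) fun z hz hzv => ?_
    · rw [IOWord.take_eq_of_le hvx'.1 hi.le, IOWord.take_eq_take_iff.1 hvx'.1 i hi]
      exact hx.1 i
    refine hwin z hz j (fun s hs hsz => ?_) ς ⟨y, hyς, hyv.trans hzv.symm⟩ fun w hw hwz => ?_
    · have h1 := (hsz.trans hzv).trans hyv.symm |>.snd_eq (hSB hs).2 hyς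
      have h2 := ((hsz.trans hzv).trans hvx').snd_eq (hS hs) hx.1
      exact hne (h1.symm.trans h2)
    · refine hBL ⟨hAB ⟨x, hx, Or.inr ⟨j, (hwz.trans hzv).trans hvx', ?_⟩⟩, hw⟩
      rw [((hwz.trans hzv).trans hyv.symm).snd_eq hw hyς]
      exact hne
  · have hxy : x.take (k + 1) = y.take (k + 1) := IOWord.take_eq_of_le hj.1.symm (by omega)
    refine ⟨x, hx, Or.inr ⟨k, hyv.symm.trans (.of_take hj.1 hjk), ?_⟩⟩
    rwa [IOWord.take_eq_take_iff.1 hxy k (by omega)]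

end Languages

/-! ### Games on complete automata -/

/-- The transitions and the colours of a complete deterministic parity automaton. -/
structure CompleteAutomaton (V I O : Type) where
  next : V → I ⊕ O → V
  col : V → ℕ

namespace CompleteAutomaton

variable {V I O : Type} (K : CompleteAutomaton V I O)

/-- The positions of the game on `K` are pairs made of a bit, which is `true` when the controller is
to move, and of a state. A move is given by an input and an output, of which only the one whose turn
it is matters. -/
def move (w : Bool × V) (γ : I × O) : Bool × V :=
  (!w.1, K.next w.2 (if w.1 then .inr γ.2 else .inl γ.1))

/-- The successor of a position when the controller and the environment use the positional
strategies `f` and `g`. -/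
def follow (f : V → O) (g : V → I) (w : Bool × V) : Bool × V :=
  K.move w (g w.2, f w.2)

/-- The play of the positional strategies `f` and `g` from `u` satisfies the parity condition. -/
def Wins (f : V → O) (g : V → I) (u : Bool × V) : Prop :=
  ParityAccepting fun t => K.col ((K.follow f g)^[t] u).2

/-- Both players together can satisfy the parity condition from `u`. -/
def Live (u : Bool × V) : Prop := ∃ f g, K.Wins f g u

/-- The controller can force the parity condition from `u`. -/
def Forced (u : Bool × V) : Prop := ∃ f, ∀ g, K.Wins f g u

/-- The positional strategy `f` of the controller satisfies the parity condition from all the states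
from which this can be forced, and leaves the environment a possibility to satisfy it from all the
states from which there is any. -/
def Good (f : V → O) : Prop :=
  ∀ a, (K.Forced (true, a) → ∀ g, K.Wins f g (true, a)) ∧
    (K.Live (true, a) → ∃ g, K.Wins f g (true, a))

theorem follow_follows (f : V → O) (g : V → I) (h : Bool × V → I × O)
    (hh : ∀ a, (h (true, a)).2 = f a) (u : Bool × V) :
    Follows (fun w => w.1 = true) K.move h fun t => (K.follow f g)^[t] u := fun t => by
  simp only [Function.iterate_succ_apply']
  refine ⟨⟨_, rfl⟩, fun ht => ?_⟩
  generalize (K.follow f g)^[t] u = w at ht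
  obtain ⟨b, a⟩ := w
  simp only at ht
  subst ht
  simp [follow, move, hh]

variable [Finite V] [Finite I] [Finite O] [Nonempty I] [Nonempty O]

/-- The possibility of satisfying the parity condition does not depend on positionality. -/
theorem live_of_path {x : ℕ → Bool × V} (hx : ∀ t, ∃ γ, x (t + 1) = K.move (x t) γ)
    (h : ParityAccepting fun t => K.col (x t).2) : K.Live (x 0) := by
  obtain ⟨F, hF⟩ := exists_positional_of_path K.move fun w => K.col w.2
  refine ⟨fun a => (F (true, a)).2, fun a => (F (false, a)).1, ?_⟩
  have e : K.follow (fun a => (F (true, a)).2) (fun a => (F (false, a)).1) =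
      fun w => K.move w (F w) := by
    funext ⟨b, a⟩
    cases b <;> rfl
  rw [Wins, e]
  exact hF x hx h

/-- A positional strategy that wins against all the positional strategies wins against all the
strategies. -/
theorem accepting_of_forall_wins {f : V → O} {x : ℕ → Bool × V}
    (h : ∀ g, K.Wins f g (x 0)) (hx : ∀ t, ∃ γ, x (t + 1) = K.move (x t) γ)
    (hf : ∀ t, (x t).1 = true → ∃ i, x (t + 1) = K.move (x t) (i, f (x t).2)) :
    ParityAccepting fun t => K.col (x t).2 := by
  by_contra hc
  obtain ⟨F, hF⟩ := exists_positional_of_path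
    (fun w γ => K.move w (γ.1, f w.2) : Bool × V → I × O → Bool × V) fun w => K.col w.2 + 1
  refine not_parityAccepting_succ (h fun a => (F (false, a)).1) ?_
  have e : K.follow f (fun a => (F (false, a)).1) =
      fun w => K.move w ((F w).1, f w.2) := by
    funext ⟨b, a⟩
    cases b <;> rfl
  rw [e]
  refine hF x (fun t => ?_) (parityAccepting_succ_of_not (fun w => K.col w.2) x hc)
  obtain ⟨o⟩ := ‹Nonempty O›
  by_cases ht : (x t).1 = true
  · obtain ⟨i, hi⟩ := hf t ht
    exact ⟨(i, o), hi⟩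
  · obtain ⟨γ, hγ⟩ := hx t
    refine ⟨γ, hγ.trans ?_⟩
    simp [move, ht]

theorem winsFrom_of_forall_wins {f : V → O} {h : Bool × V → I × O}
    (hh : ∀ a, (h (true, a)).2 = f a) {u : Bool × V} (hw : ∀ g, K.Wins f g u) :
    WinsFrom (fun w => w.1 = true) K.move (fun w => K.col w.2) h u := by
  rintro x rfl hx
  refine K.accepting_of_forall_wins hw (fun t => (hx t).1) fun t ht => ?_
  refine ⟨(h (x t)).1, ((hx t).2 ht).trans ?_⟩
  rw [← hh, ← ht]

/-- A position from which the controller cannot force the parity condition is covered by a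
spoiler. -/
theorem forced_or_exists_spoiler (u : Bool × V) : K.Forced u ∨
    ∃ (P : Spoiler (fun w => w.1 = true) K.move (fun w => K.col w.2) fun _ _ => True) (m : P.M),
      P.pos m = u := by
  obtain ⟨h, P, hP⟩ := exists_positional (fun w => w.1 = true) K.move fun w => K.col w.2
  refine (hP u).imp (fun hu => ?_) fun ⟨m, hm⟩ => ⟨P, m, hm⟩
  exact ⟨fun a => (h (true, a)).2, fun g => hu _ rfl (K.follow_follows _ g h (fun _ => rfl) u)⟩

/-- A good strategy plays to win where this is possible, and cooperatively elsewhere. -/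
theorem exists_good : ∃ f, K.Good f := by
  classical
  obtain ⟨h, P, hP⟩ := exists_positional (fun w => w.1 = true) K.move fun w => K.col w.2
  obtain ⟨F, hF⟩ := exists_positional_of_path K.move fun w => K.col w.2
  set U : Bool × V → Prop := WinsFrom (fun w => w.1 = true) K.move (fun w => K.col w.2) h with hU
  let f : V → O := fun a => if U (true, a) then (h (true, a)).2 else (F (true, a)).2
  have hUnext : ∀ w w', U w → (∃ γ, w' = K.move w γ) →
      (w.1 = true → w' = K.move w (h w)) → U w' := by
    rintro w w' hw h1 h2 x rfl hx
    have := hw (fun t => Nat.casesOn t w x) rfl fun t => by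
      cases t with
      | zero => exact ⟨h1, h2⟩
      | succ t => exact hx t
    rwa [← parityAccepting_shift _ 1] at this
  have hUf : ∀ g u, U u → K.Wins f g u := by
    intro g u hu
    have hstep : ∀ w, U w → w.1 = true → K.follow f g w = K.move w (h w) := by
      rintro ⟨b, a⟩ hw rfl
      simp [follow, move, f, hw]
    have hall : ∀ t, U ((K.follow f g)^[t] u) := fun t => by
      induction t with
      | zero => exact hu
      | succ t ih =>
        rw [Function.iterate_succ_apply']
        exact hUnext _ _ ih ⟨_, rfl⟩ (hstep _ ih)
    refine hu _ rfl fun t => ?_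
    simp only [Function.iterate_succ_apply']
    exact ⟨⟨_, rfl⟩, hstep _ (hall t)⟩
  refine ⟨f, fun a => ⟨?_, ?_⟩⟩
  · rintro ⟨f', hf'⟩ g
    refine hUf g _ ((hP _).resolve_right ?_)
    rintro ⟨m, hm⟩
    obtain ⟨i⟩ := ‹Nonempty I›
    exact P.not_winsFrom (f := fun w => (i, f' w.2)) (fun _ => trivial) m
      (hm ▸ K.winsFrom_of_forall_wins (fun _ => rfl) hf')
  · rintro ⟨f', g', hw⟩
    let g : V → I := fun a => (F (false, a)).1
    refine ⟨g, ?_⟩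
    have hFw := hF (fun t => (K.follow f' g')^[t] (true, a))
      (fun t => ⟨_, Function.iterate_succ_apply' _ _ _⟩) hw
    by_cases hex : ∃ t, U ((K.follow f g)^[t] (true, a))
    · obtain ⟨t, ht⟩ := hex
      have := hUf g _ ht
      rw [Wins] at this ⊢
      simp only [← Function.iterate_add_apply] at this
      rwa [parityAccepting_shift (fun s => K.col ((K.follow f g)^[s] (true, a)).2) t] at this
    · push Not at hex
      have e : ∀ t, (K.follow f g)^[t] (true, a) = (fun w => K.move w (F w))^[t] (true, a) := by
        intro t
        induction t with
        | zero => rfl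
        | succ t ih =>
          have ht := hex t
          rw [Function.iterate_succ_apply', Function.iterate_succ_apply', ← ih]
          generalize (K.follow f g)^[t] (true, a) = w at ht
          obtain ⟨b, c⟩ := w
          cases b
          · rfl
          · simp [follow, move, f, ht]
      rw [Wins]
      simp only [e]
      exact hFw

end CompleteAutomaton

namespace CompleteAutomaton

variable {V I O : Type} (K : CompleteAutomaton V I O)

/-! ### Runs along words -/

/-- The position after `t` signals of the word `w`, from the initial state `a`. -/
def posAt (a : V) (w : IOWord I O) : ℕ → Bool × V
  | 0 => (false, a)
  | t + 1 => K.move (posAt a w t) (w (t / 2))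

/-- The state after a finite word, from the initial state `a`. -/
def stateAfter (a : V) (h : List (I × O)) : V :=
  h.foldl (fun b γ => K.next (K.next b (.inl γ.1)) (.inr γ.2)) a

/-- The run along `w` satisfies the parity condition. -/
def Accepting (a : V) (w : IOWord I O) : Prop :=
  ParityAccepting fun t => K.col (K.posAt a w t).2

variable {K} {a : V} {w x : IOWord I O}

theorem posAt_fst (t : ℕ) : (K.posAt a w t).1 = decide (t % 2 = 1) := by
  induction t with
  | zero => rfl
  | succ t ih =>
    rw [posAt, move, ih]
    rcases Nat.mod_two_eq_zero_or_one t with h | h <;> simp [Nat.add_mod, h]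

theorem posAt_even (k : ℕ) : K.posAt a w (2 * k) = (false, K.stateAfter a (w.take k)) := by
  induction k with
  | zero => rfl
  | succ k ih =>
    rw [Nat.mul_succ, posAt, posAt, ih, IOWord.take_succ, show (2 * k + 1) / 2 = k by omega,
      show 2 * k / 2 = k by omega]
    simp only [stateAfter, List.foldl_append]
    rfl

theorem posAt_odd (k : ℕ) : K.posAt a w (2 * k + 1) =
    (true, K.next (K.stateAfter a (w.take k)) (.inl (w k).1)) := by
  rw [posAt, posAt_even, show 2 * k / 2 = k by omega]
  rfl

theorem posAt_odd_succ (k : ℕ) : K.posAt a w (2 * (k + 1)) =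
    (false, K.next (K.posAt a w (2 * k + 1)).2 (.inr (w k).2)) := by
  rw [Nat.mul_succ, posAt, move, posAt_odd, show (2 * k + 1) / 2 = k by omega]
  rfl

theorem posAt_congr {k : ℕ} (h : Agree w x k) :
    K.posAt a w (2 * k + 1) = K.posAt a x (2 * k + 1) := by
  rw [posAt_odd, posAt_odd, h.1, h.2]

theorem accepting_iff_shift (t₀ : ℕ) :
    K.Accepting a w ↔ ParityAccepting fun t => K.col (K.posAt a w (t + t₀)).2 :=
  (parityAccepting_shift (fun t => K.col (K.posAt a w t).2) t₀).symm

/-- Paths of the game that start on the run of `w` are runs of words that share a beginning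
with `w`. -/
theorem exists_word_of_path (t₀ : ℕ) {z : ℕ → Bool × V} (h0 : z 0 = K.posAt a w t₀)
    (hz : ∀ t, ∃ γ, z (t + 1) = K.move (z t) γ) :
    ∃ x : IOWord I O, (∀ j, 2 * j + 1 < t₀ → x j = w j) ∧ (∀ j, 2 * j < t₀ → (x j).1 = (w j).1) ∧
      ∀ t, K.posAt a x (t + t₀) = z t := by
  choose γ hγ using hz
  let c : ℕ → I × O := fun t => if t < t₀ then w (t / 2) else γ (t - t₀)
  let x : IOWord I O := fun j => ((c (2 * j)).1, (c (2 * j + 1)).2)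
  have hstep : ∀ t, K.posAt a x (t + 1) = K.move (K.posAt a x t) (c t) := fun t => by
    rw [posAt, move, move, posAt_fst]
    rcases Nat.mod_two_eq_zero_or_one t with h | h
    · have : 2 * (t / 2) = t := by omega
      simp [h, x, this]
    · have : 2 * (t / 2) + 1 = t := by omega
      simp [h, x, this]
  have hpre : ∀ t ≤ t₀, K.posAt a x t = K.posAt a w t := fun t => by
    induction t with
    | zero => intro _; rfl
    | succ t ih =>
      intro ht
      rw [hstep, ih (by omega), posAt]
      simp [c, show t < t₀ by omega]
  refine ⟨x, fun j hj => ?_, fun j hj => ?_, fun t => ?_⟩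
  · simp [x, c, hj, show 2 * j < t₀ by omega, show (2 * j + 1) / 2 = j by omega]
  · simp [x, c, hj]
  · induction t with
    | zero => rw [Nat.zero_add, hpre _ le_rfl, h0]
    | succ t ih =>
      rw [Nat.add_right_comm, hstep, ih, hγ]
      simp [c]

theorem Live.exists_word {t₀ : ℕ} (h : K.Live (K.posAt a w t₀)) :
    ∃ x : IOWord I O, (∀ j, 2 * j + 1 < t₀ → x j = w j) ∧ (∀ j, 2 * j < t₀ → (x j).1 = (w j).1) ∧
      K.Accepting a x := by
  obtain ⟨f, g, hfg⟩ := h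
  obtain ⟨x, h1, h2, h3⟩ := exists_word_of_path (K := K) (a := a) (w := w) t₀
    (z := fun t => (K.follow f g)^[t] (K.posAt a w t₀)) rfl
    fun t => ⟨_, Function.iterate_succ_apply' _ _ _⟩
  refine ⟨x, h1, h2, (accepting_iff_shift t₀).2 ?_⟩
  simp only [h3]
  exact hfg

theorem live_posAt [Finite V] [Finite I] [Finite O] [Nonempty I] [Nonempty O]
    (h : K.Accepting a w) (t₀ : ℕ) : K.Live (K.posAt a w t₀) := by
  have := K.live_of_path (x := fun t => K.posAt a w (t + t₀))
    (fun t => ⟨w ((t + t₀) / 2), by rw [Nat.add_right_comm]; rfl⟩) ((accepting_iff_shift t₀).1 h)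
  rwa [Nat.zero_add] at this

/-- If the players follow positional strategies along `w` from round `k` on, then so does
the run. -/
theorem posAt_eq_follow {f : V → O} {g : V → I} {k : ℕ}
    (hf : ∀ j ≥ k, (w j).2 = f (K.posAt a w (2 * j + 1)).2)
    (hg : ∀ j > k, (w j).1 = g (K.stateAfter a (w.take j))) (t : ℕ) :
    K.posAt a w (t + (2 * k + 1)) = (K.follow f g)^[t] (K.posAt a w (2 * k + 1)) := by
  induction t with
  | zero => rw [Nat.zero_add]; rfl
  | succ t ih =>
    rw [Function.iterate_succ_apply', ← ih, Nat.add_right_comm]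
    rcases Nat.even_or_odd' (t + (2 * k + 1)) with ⟨j, h | h⟩
    · rw [h, posAt, follow, posAt_even, show 2 * j / 2 = j by omega, move, move]
      simp [hg j (by omega)]
    · rw [h, posAt, follow, show (2 * j + 1) / 2 = j by omega, move, move]
      simp [posAt_fst, hf j (by omega)]

end CompleteAutomaton

open CompleteAutomaton

section Strategies

variable {I O : Type}

/-- A beginning of a play that respects the strategy of the controller can be prolonged by any
behaviour of the environment. -/
theorem exists_mem_out_agree_env {σ : Strategy I O} {w : IOWord I O} {k : ℕ}
    (h : ∀ j < k, (w j).2 = σ (w.take j) (w j).1) (g : List (I × O) → I) :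
    ∃ x ∈ σ.Out, Agree x w k ∧ ∀ j > k, (x j).1 = g (x.take j) := by
  let τ : EnvStrategy I O := fun u => if u.length ≤ k then (w u.length).1 else g u
  refine ⟨play σ τ, play_mem_out _ _, ⟨take_play_eq (fun j hj => ?_) h, ?_⟩, fun j hj => ?_⟩
  · simp [τ, IOWord.length_take, hj.le]
  · rw [play_mem_env_out σ τ k]
    simp [τ, IOWord.length_take]
  · rw [play_mem_env_out σ τ j]
    simp [τ, IOWord.length_take, hj]

/-- If the controller has a winning strategy, with arbitrary memory, after some beginning of a play
then it can force the parity condition from the position that is reached. -/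
theorem forced_of_strategy {V : Type} {K : CompleteAutomaton V I O} [Finite V] [Finite I] [Finite O]
    [Nonempty I] [Nonempty O] {a : V} {ς : Strategy I O} {w : IOWord I O} {k : ℕ} (hw : w ∈ ς.Out)
    (h : ∀ x ∈ ς.Out, Agree x w k → K.Accepting a x) : K.Forced (K.posAt a w (2 * k + 1)) := by
  refine (K.forced_or_exists_spoiler _).resolve_right ?_
  rintro ⟨P, m, hm⟩
  -- The environment answers with the spoiler, of which it remembers the state and the last input.
  have hatt : ∀ (m : P.M) (i : I) (o : O), ∃ m' : P.M, (P.pos m).1 = true →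
      P.rel m m' ∧ P.pos m' = K.move (P.pos m) (i, o) := fun m i o => by
    by_cases hp : (P.pos m).1 = true
    · obtain ⟨m', h1, h2⟩ := P.attack m hp (i, o) trivial
      exact ⟨m', fun _ => ⟨h1, h2⟩⟩
    · exact ⟨m, fun h => absurd h hp⟩
  have hdef : ∀ m : P.M, ∃ (m' : P.M) (i : I), (P.pos m).1 = false →
      P.rel m m' ∧ ∃ o, P.pos m' = K.move (P.pos m) (i, o) := fun m => by
    by_cases hp : (P.pos m).1 = false
    · obtain ⟨m', h1, γ, h2⟩ := P.defend m (by simp [hp])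
      exact ⟨m', γ.1, fun _ => ⟨h1, γ.2, h2⟩⟩
    · obtain ⟨i⟩ := ‹Nonempty I›
      exact ⟨m, i, fun h => absurd h hp⟩
  choose att hatt using hatt
  choose dfd inp hdef using hdef
  obtain ⟨i₀⟩ := ‹Nonempty I›
  let mem : List (I × O) → P.M := fun u =>
    u.foldl (fun m γ => dfd (att m i₀ γ.2)) m
  obtain ⟨x, hx, hxw, hxg⟩ := exists_mem_out_agree_env (σ := ς) (w := w) (k := k)
    (fun j _ => hw j) fun u => inp (att (mem (u.drop k).dropLast) i₀ (u.getLast?.elim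
      (ς [] i₀) Prod.snd))
  let ms : ℕ → P.M := fun t => mem ((x.take (k + t)).drop k)
  let mid : ℕ → P.M := fun t => att (ms t) i₀ (x (k + t)).2
  have hdrop : ∀ t, (x.take (k + (t + 1))).drop k = (x.take (k + t)).drop k ++ [x (k + t)] :=
    fun t => by
      rw [← Nat.add_assoc, IOWord.take_succ, List.drop_append_of_le_length]
      rw [IOWord.length_take]; omega
  have hms : ∀ t, ms (t + 1) = dfd (mid t) := fun t => by
    simp only [ms, mid, hdrop, mem, List.foldl_append]
    rfl
  have hinp : ∀ t, (x (k + (t + 1))).1 = inp (mid t) := fun t => by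
    rw [hxg _ (by omega), hdrop, List.dropLast_concat, ← Nat.add_assoc, IOWord.take_succ,
      List.getLast?_concat]
    rfl
  have hpos : ∀ t, P.pos (ms t) = K.posAt a x (2 * (k + t) + 1) ∧
      P.pos (mid t) = K.posAt a x (2 * (k + t) + 2) := by
    have hmid : ∀ t, P.pos (ms t) = K.posAt a x (2 * (k + t) + 1) →
        P.pos (mid t) = K.posAt a x (2 * (k + t) + 2) := fun t ht => by
      have h1 : (P.pos (ms t)).1 = true := by
        rw [ht, posAt_odd]
      change _ = K.move (K.posAt a x (2 * (k + t) + 1)) (x ((2 * (k + t) + 1) / 2))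
      rw [(hatt _ _ _ h1).2, ht, show (2 * (k + t) + 1) / 2 = k + t by omega, move, move,
        posAt_odd]
      rfl
    have hodd : ∀ t, P.pos (ms t) = K.posAt a x (2 * (k + t) + 1) := fun t => by
      induction t with
      | zero =>
        have : ms 0 = m := by
          simp only [ms, Nat.add_zero]
          rw [List.drop_eq_nil_of_le (by rw [IOWord.length_take])]
          rfl
        rw [this, hm]
        exact (posAt_congr hxw).symm
      | succ t ih =>
        have h2 := hmid t ih
        have e : 2 * (k + t) + 2 = 2 * (k + (t + 1)) := by omega
        have h1 : (P.pos (mid t)).1 = false := by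
          rw [h2, e, posAt_even]
        obtain ⟨o, ho⟩ := (hdef _ h1).2
        rw [hms, ho, h2, e, posAt, show 2 * (k + (t + 1)) / 2 = k + (t + 1) by omega, move, move,
          posAt_even]
        simp [hinp]
    exact fun t => ⟨hodd t, hmid t (hodd t)⟩
  let y : ℕ → P.M := fun t => if t % 2 = 0 then ms (t / 2) else mid (t / 2)
  have hy : ∀ t, P.pos (y t) = K.posAt a x (t + (2 * k + 1)) := fun t => by
    rcases Nat.mod_two_eq_zero_or_one t with h | h
    · simp only [y, h, if_true, (hpos _).1]
      congr 1
      omega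
    · simp only [y, h]
      simp only [one_ne_zero, if_false, (hpos _).2]
      congr 1
      omega
  refine P.bad y (fun t => ?_) ?_
  · have hp : (P.pos (y t)).1 = decide ((t + (2 * k + 1)) % 2 = 1) := by rw [hy, posAt_fst]
    rcases Nat.mod_two_eq_zero_or_one t with h | h
    · have h1 : y t = ms (t / 2) := by simp [y, h]
      have h2 : y (t + 1) = mid (t / 2) := by
        simp [y, show (t + 1) % 2 = 1 by omega, show (t + 1) / 2 = t / 2 by omega]
      rw [h1, h2]
      refine (hatt _ _ _ ?_).1
      rw [← h1, hp]
      exact decide_eq_true (by omega)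
    · have h1 : y t = mid (t / 2) := by simp [y, h]
      have h2 : y (t + 1) = dfd (mid (t / 2)) := by
        simp [y, show (t + 1) % 2 = 0 by omega, show (t + 1) / 2 = t / 2 + 1 by omega, hms]
      rw [h1, h2]
      refine (hdef _ ?_).1
      rw [← h1, hp]
      exact decide_eq_false (by omega)
  · have := (accepting_iff_shift (2 * k + 1)).1 (h x hx hxw)
    simpa only [hy] using this

/-! ### The strategy of the controller -/

variable {V U : Type} (K : CompleteAutomaton V I O) (N : CompleteAutomaton U I O) (a₀ : V) (b₀ : U)

/-- The output chosen in the states `a` of the specification and `b` of the scenario: the output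
that the scenario requires, if there is one, and that of the positional strategy `f` otherwise. The
function `pick` chooses the former. -/
noncomputable def choice (f : V → O) (pick : U → O) (a : V) (b : U) : O :=
  open Classical in if ∃ o, N.Live (false, N.next b (.inr o)) then pick b else f a

/-- The strategy of the controller that makes these choices. -/
noncomputable def controller (f : V → O) (pick : U → O) : Strategy I O := fun h i =>
  choice N f pick (K.next (K.stateAfter a₀ h) (.inl i)) (N.next (N.stateAfter b₀ h) (.inl i))

variable {K N a₀ b₀} {L S : IOLang I O} {f : V → O} {pick : U → O}

theorem controller_take (w : IOWord I O) (k : ℕ) :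
    controller K N a₀ b₀ f pick (w.take k) (w k).1 =
      choice N f pick (K.posAt a₀ w (2 * k + 1)).2 (N.posAt b₀ w (2 * k + 1)).2 := by
  rw [posAt_odd, posAt_odd]
  rfl

/-- A live successor in the automaton of the scenario is witnessed by a word of the scenario. -/
theorem exists_mem_of_live (hS : ∀ w, w ∈ S ↔ N.Accepting b₀ w) {w : IOWord I O} {k : ℕ} {o : O}
    (h : N.Live (false, N.next (N.posAt b₀ w (2 * k + 1)).2 (.inr o))) :
    ∃ s ∈ S, Agree s w k ∧ (s k).2 = o := by
  classical
  let x : IOWord I O := Function.update w k ((w k).1, o)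
  have hk : x k = ((w k).1, o) := Function.update_self ..
  have hxw : Agree x w k := by
    refine ⟨IOWord.take_eq_take_iff.2 fun j hj => Function.update_of_ne hj.ne _ _, ?_⟩
    rw [hk]
  have hp : N.posAt b₀ x (2 * (k + 1)) =
      (false, N.next (N.posAt b₀ w (2 * k + 1)).2 (.inr o)) := by
    rw [posAt_odd_succ, posAt_congr hxw, hk]
  rw [← hp] at h
  obtain ⟨s, h1, h2, h3⟩ := h.exists_word
  refine ⟨s, (hS s).2 h3, .trans ⟨?_, ?_⟩ hxw, ?_⟩
  · exact IOWord.take_eq_take_iff.2 fun j hj => h1 j (by omega)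
  · exact h2 k (by omega)
  · rw [h1 k (by omega), hk]

variable [Finite V] [Finite U] [Finite I] [Finite O] [Nonempty I] [Nonempty O]

/-- The strategy obeys the scenario, because the scenario is coherent, and it makes the assumption
optimal. It also never loses the possibility of an outcome in `L`, which the automaton of the
assumption relies on. -/
theorem ensurableOptimal_controller (hL : ∀ w, w ∈ L ↔ K.Accepting a₀ w)
    (hS : ∀ w, w ∈ S ↔ N.Accepting b₀ w) (hcoh : Coherent S) (hSL : S ⊆ L) (hf : K.Good f)
    (hpick : ∀ b, (∃ o, N.Live (false, N.next b (.inr o))) →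
      N.Live (false, N.next b (.inr (pick b)))) :
    EnsurableOptimal (assumption (controller K N a₀ b₀ f pick) L) L S ∧
      ∀ x ∈ (controller K N a₀ b₀ f pick).Out, ∀ w ∈ L, ∀ k, Agree w x k →
        ∃ y ∈ (controller K N a₀ b₀ f pick).Out ∩ L, Agree y x k := by
  set σ := controller K N a₀ b₀ f pick with hσ
  have hSσ : S ⊆ σ.Out := fun s hs k => by
    have hlive : N.Live (false, N.next (N.posAt b₀ s (2 * k + 1)).2 (.inr (s k).2)) := by
      rw [← posAt_odd_succ]
      exact live_posAt ((hS s).1 hs) _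
    have hex : ∃ o, N.Live (false, N.next (N.posAt b₀ s (2 * k + 1)).2 (.inr o)) := ⟨_, hlive⟩
    obtain ⟨s', hs', h1, h2⟩ := exists_mem_of_live hS (hpick _ hex)
    rw [hσ, controller_take, choice, if_pos hex, ← h2]
    exact hcoh s hs s' hs' k h1.1.symm h1.2.symm
  -- Outside of the scenario, the strategy is positional.
  have hoff : ∀ (x : IOWord I O) (k : ℕ), (∀ s ∈ S, ¬ Agree s x k) → ∀ y ∈ σ.Out, Agree y x k →
      ∀ j ≥ k, (y j).2 = f (K.posAt a₀ y (2 * j + 1)).2 := by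
    intro x k hx y hy hyx j hj
    rw [hy j, hσ, controller_take, choice, if_neg]
    rintro ⟨o, ho⟩
    obtain ⟨s, hs, h, -⟩ := exists_mem_of_live hS ho
    refine hx s hs (.trans ?_ hyx)
    rcases hj.eq_or_lt with rfl | hj
    · exact h
    · exact .of_take h.1 hj
  have hcoop : ∀ x ∈ σ.Out, ∀ w ∈ L, ∀ k, Agree w x k → ∃ y ∈ σ.Out ∩ L, Agree y x k := by
    intro x hx w hw k hwx
    by_cases hin : ∃ s ∈ S, Agree s x k
    · obtain ⟨s, hs, h⟩ := hin
      exact ⟨s, ⟨hSσ hs, hSL hs⟩, h⟩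
    push Not at hin
    have hlive := live_posAt ((hL w).1 hw) (2 * k + 1)
    rw [posAt_congr hwx, posAt_odd] at hlive
    obtain ⟨g, hg⟩ := (hf _).2 hlive
    rw [← posAt_odd] at hg
    obtain ⟨y, hy, hyx, hyg⟩ := exists_mem_out_agree_env (σ := σ) (w := x) (k := k)
      (fun j _ => hx j) fun u => g (K.stateAfter a₀ u)
    refine ⟨y, ⟨hy, (hL y).2 ((accepting_iff_shift (2 * k + 1)).2 ?_)⟩, hyx⟩
    simp only [posAt_eq_follow (hoff x k hin y hy hyx) hyg, posAt_congr hyx]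
    exact hg
  refine ⟨ensurableOptimal_assumption hSL hSσ hcoop ?_, hcoop⟩
  rintro x hx k hin ς ⟨y, hy, hyx⟩ hς
  have hforced : K.Forced (K.posAt a₀ y (2 * k + 1)) :=
    forced_of_strategy hy fun w hw hwy => (hL w).1 (hς w hw (hwy.trans hyx))
  rw [posAt_congr hyx, posAt_odd] at hforced
  have hwins := (hf _).1 hforced
  rw [← posAt_odd] at hwins
  rw [hL, accepting_iff_shift (2 * k + 1)]
  refine K.accepting_of_forall_wins (f := f) (x := fun t => K.posAt a₀ x (t + (2 * k + 1)))
    (by simpa only [Nat.zero_add] using hwins)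
    (fun t => ⟨x ((t + (2 * k + 1)) / 2), by rw [Nat.add_right_comm]; rfl⟩) fun t ht => ?_
  have hodd : (t + (2 * k + 1)) % 2 = 1 := by
    rw [posAt_fst] at ht
    exact of_decide_eq_true ht
  obtain ⟨j, hj⟩ : ∃ j, t + (2 * k + 1) = 2 * j + 1 := ⟨(t + (2 * k + 1)) / 2, by omega⟩
  refine ⟨(x j).1, ?_⟩
  rw [Nat.add_right_comm, hj, ← hoff x k hin x hx ⟨rfl, rfl⟩ j (by omega), posAt,
    show (2 * j + 1) / 2 = j by omega]

end Strategies

section Automata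

variable {Q I O : Type}

/-! ### Completion of parity automata -/

/-- The completion of a parity automaton by a rejecting state. -/
def ParityAutomaton.complete (M : ParityAutomaton Q I O) : CompleteAutomaton (Option Q) I O where
  next a x := a.bind fun s => M.step s x
  col a := a.elim 1 M.colour

theorem IOWord.letters_even (w : IOWord I O) (k : ℕ) : w.letters (2 * k) = .inl (w k).1 := by
  rw [IOWord.letters, if_pos (by omega), show 2 * k / 2 = k by omega]

theorem IOWord.letters_odd (w : IOWord I O) (k : ℕ) : w.letters (2 * k + 1) = .inr (w k).2 := by
  rw [IOWord.letters, if_neg (by omega), show (2 * k + 1) / 2 = k by omega]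

theorem IOWord.letters_injective : Function.Injective (IOWord.letters : IOWord I O → _) := by
  intro w x h
  funext k
  have h1 := congrFun h (2 * k)
  have h2 := congrFun h (2 * k + 1)
  rw [letters_even, letters_even] at h1
  rw [letters_odd, letters_odd] at h2
  exact Prod.ext (Sum.inl.inj h1) (Sum.inr.inj h2)

theorem CompleteAutomaton.posAt_succ_snd {V : Type} (K : CompleteAutomaton V I O) (a : V)
    (w : IOWord I O) (t : ℕ) :
    (K.posAt a w (t + 1)).2 = K.next (K.posAt a w t).2 (w.letters t) := by
  rw [posAt, move, posAt_fst, IOWord.letters]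
  rcases Nat.mod_two_eq_zero_or_one t with h | h <;> simp [h]

theorem ParityAutomaton.accepts_letters_iff (M : ParityAutomaton Q I O) (w : IOWord I O) :
    M.Accepts w.letters ↔ M.complete.Accepting (some M.start) w := by
  constructor
  · rintro ⟨ρ, ⟨h0, hρ⟩, hacc⟩
    have h : ∀ t, (M.complete.posAt (some M.start) w t).2 = some (ρ t) := fun t => by
      induction t with
      | zero => rw [h0]; rfl
      | succ t ih =>
        rw [posAt_succ_snd, ih]
        exact hρ t
    rw [Accepting]
    simp only [h]
    exact hacc
  · intro hacc
    have hsome : ∀ t, ∃ s, (M.complete.posAt (some M.start) w t).2 = some s := by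
      intro t
      by_contra! hc
      have hnone : ∀ k, (M.complete.posAt (some M.start) w (k + t)).2 = none := fun k => by
        induction k with
        | zero =>
          rw [Nat.zero_add]
          exact Option.eq_none_iff_forall_ne_some.2 hc
        | succ k ih =>
          rw [Nat.add_right_comm, posAt_succ_snd, ih]
          rfl
      obtain ⟨e, he, hinf, -⟩ := (accepting_iff_shift t).1 hacc
      obtain ⟨j, -, hj⟩ := hinf 0
      simp only [hnone] at hj
      rw [← hj] at he
      exact Nat.not_even_one he
    choose ρ hρ using hsome
    refine ⟨ρ, ⟨?_, fun t => ?_⟩, ?_⟩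
    · exact (Option.some.inj (hρ 0)).symm
    · have := hρ (t + 1)
      rw [posAt_succ_snd, hρ t] at this
      exact this
    · rw [Accepting] at hacc
      simp only [hρ] at hacc
      exact hacc

theorem ParityAutomaton.Recognises.mem_iff {M : ParityAutomaton Q I O} {L : IOLang I O}
    (h : M.Recognises L) (w : IOWord I O) :
    w ∈ L ↔ M.complete.Accepting (some M.start) w := by
  rw [← M.accepts_letters_iff, ← IOWord.letters_injective.mem_set_image, ← h]
  rfl

/-! ### The automaton of the assumption -/

variable {V U : Type} (K : CompleteAutomaton V I O) (N : CompleteAutomaton U I O) (a₀ : V) (b₀ : U)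
  (f : V → O) (pick : U → O)

open Classical in
/-- The automaton of the assumption that belongs to the strategy `controller`. It runs the automata
of the specification and of the scenario in parallel, together with a bit that tells whose turn it
is. When the output is not the one that the strategy chooses, it accepts everything that follows,
unless the specification cannot be satisfied any more; the state of the scenario is then `none`. -/
noncomputable def assumptionAutomaton : ParityAutomaton (Bool × V × Option U) I O where
  start := (false, a₀, some b₀)
  step
    | (false, a, none), .inl _ => some (true, a, none)
    | (true, a, none), .inr _ => some (false, a, none)
    | (false, a, some b), .inl i => some (true, K.next a (.inl i), some (N.next b (.inl i)))
    | (true, a, some b), .inr o =>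
      if o = choice N f pick a b then some (false, K.next a (.inr o), some (N.next b (.inr o)))
      else if K.Live (true, a) then some (false, a, none) else none
    | (false, _, _), .inr _ => none
    | (true, _, _), .inl _ => none
  colour
    | (_, _, none) => 0
    | (_, a, some _) => K.col a

variable {K N a₀ b₀ f pick} {L : IOLang I O}

/-- A word that leaves the outcomes of the strategy while the specification can still be satisfied
is accepted in the sink, whose colour is `0`. -/
theorem assumptionAutomaton_accepts_of_live {w x : IOWord I O} {k : ℕ}
    (hx : x ∈ (controller K N a₀ b₀ f pick).Out) (hwx : Agree w x k) (hne : (w k).2 ≠ (x k).2)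
    (hlive : K.Live (K.posAt a₀ w (2 * k + 1))) :
    (assumptionAutomaton K N a₀ b₀ f pick).Accepts w.letters := by
  refine ⟨fun t => if t < 2 * k + 2 then
      ((K.posAt a₀ w t).1, (K.posAt a₀ w t).2, some (N.posAt b₀ w t).2)
    else (decide (t % 2 = 1), (K.posAt a₀ w (2 * k + 1)).2, none), ⟨?_, fun t => ?_⟩, ?_⟩
  · simp [posAt, assumptionAutomaton]
  · beta_reduce
    rcases lt_trichotomy t (2 * k + 1) with h | rfl | h
    · rw [if_pos (by omega), if_pos (by omega), posAt_succ_snd, posAt_succ_snd, posAt_fst,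
        posAt_fst]
      rcases Nat.even_or_odd' t with ⟨j, rfl | rfl⟩
      · rw [IOWord.letters_even]
        simp [assumptionAutomaton, Nat.add_mod]
      · have hj : (w j).2 = choice N f pick (K.posAt a₀ w (2 * j + 1)).2
            (N.posAt b₀ w (2 * j + 1)).2 := by
          have hjk : Agree w x j := .of_take hwx.1 (by omega)
          rw [← controller_take, hjk.1, hjk.2, ← hx j,
            IOWord.take_eq_take_iff.1 hwx.1 j (by omega)]
        rw [IOWord.letters_odd]
        simp [assumptionAutomaton, Nat.add_mod, ← hj]
    · have hk : (w k).2 ≠ choice N f pick (K.posAt a₀ w (2 * k + 1)).2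
          (N.posAt b₀ w (2 * k + 1)).2 := by
        rwa [← controller_take, hwx.1, hwx.2, ← hx k]
      have hl : K.Live (true, (K.posAt a₀ w (2 * k + 1)).2) := by
        convert hlive using 1
        rw [posAt_odd]
      rw [if_pos (by omega), if_neg (by omega), posAt_fst, IOWord.letters_odd]
      simp [assumptionAutomaton, Nat.add_mod, hk, hl]
    · rw [if_neg (by omega), if_neg (by omega)]
      rcases Nat.even_or_odd' t with ⟨j, rfl | rfl⟩
      · rw [IOWord.letters_even]
        simp [assumptionAutomaton, Nat.add_mod]
      · rw [IOWord.letters_odd]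
        simp [assumptionAutomaton, Nat.add_mod]
  · refine ParityAccepting.congr_eventually (c := fun _ => 0) ?_ (2 * k + 2) fun j hj => ?_
    · exact ⟨0, Even.zero, fun i => ⟨i, le_rfl, rfl⟩, fun _ _ => Nat.zero_le _⟩
    · beta_reduce
      rw [if_neg (by omega)]
      rfl

/-- As long as the outputs are those of the strategy, the automaton of the assumption runs the two
given automata in parallel. -/
theorem assumptionAutomaton_path_eq {w : IOWord I O} {ρ : ℕ → Bool × V × Option U} {k : ℕ}
    (hρ : (assumptionAutomaton K N a₀ b₀ f pick).IsPath ρ w.letters)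
    (hw : ∀ j < k, (w j).2 = controller K N a₀ b₀ f pick (w.take j) (w j).1) :
    ∀ t ≤ 2 * k + 1, ρ t = (decide (t % 2 = 1), (K.posAt a₀ w t).2, some (N.posAt b₀ w t).2) := by
  intro t
  induction t with
  | zero => intro _; rw [hρ.1]; rfl
  | succ t ih =>
    intro ht
    have h := hρ.2 t
    rw [ih (by omega)] at h
    rw [posAt_succ_snd, posAt_succ_snd]
    rcases Nat.even_or_odd' t with ⟨j, rfl | rfl⟩
    · rw [IOWord.letters_even] at h ⊢
      simp only [assumptionAutomaton, Nat.mul_mod_right, zero_ne_one, decide_false,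
        Option.some.injEq] at h
      rw [← h]
      simp [Nat.add_mod]
    · have hj := hw j (by omega)
      rw [controller_take] at hj
      rw [IOWord.letters_odd] at h ⊢
      simp only [assumptionAutomaton, Nat.mul_add_mod, Nat.one_mod, decide_true, ← hj, if_true,
        Option.some.injEq] at h
      rw [← h]
      simp [Nat.add_mod]

theorem assumptionAutomaton_accepts_of_mem_out {w : IOWord I O}
    (hw : w ∈ (controller K N a₀ b₀ f pick).Out) (hacc : K.Accepting a₀ w) :
    (assumptionAutomaton K N a₀ b₀ f pick).Accepts w.letters := by
  refine ⟨fun t => (decide (t % 2 = 1), (K.posAt a₀ w t).2, some (N.posAt b₀ w t).2),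
    ⟨rfl, fun t => ?_⟩, hacc⟩
  simp only [posAt_succ_snd]
  rcases Nat.even_or_odd' t with ⟨j, rfl | rfl⟩
  · rw [IOWord.letters_even]
    simp [assumptionAutomaton, Nat.add_mod]
  · have hj := hw j
    rw [controller_take] at hj
    rw [IOWord.letters_odd]
    simp [assumptionAutomaton, Nat.add_mod, ← hj]

/-- The automaton accepts only words in which inputs and outputs alternate. -/
theorem exists_eq_letters_of_accepts [Nonempty I] [Nonempty O] {u : ℕ → I ⊕ O}
    (h : (assumptionAutomaton K N a₀ b₀ f pick).Accepts u) : ∃ w : IOWord I O, w.letters = u := by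
  obtain ⟨ρ, ⟨h0, hρ⟩, -⟩ := h
  have hstep : ∀ s x s', (assumptionAutomaton K N a₀ b₀ f pick).step s x = some s' →
      s'.1 = !s.1 ∧ (s.1 = false → ∃ i, x = .inl i) ∧ (s.1 = true → ∃ o, x = .inr o) := by
    rintro ⟨c, a, b⟩ x s' h
    cases c <;> cases b <;> cases x <;> simp only [assumptionAutomaton] at h <;>
      try split_ifs at h
    all_goals try simp only [reduceCtorEq, Option.some.injEq] at h
    all_goals subst h; simp
  have hpar : ∀ t, (ρ t).1 = decide (t % 2 = 1) := fun t => by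
    induction t with
    | zero => rw [h0]; rfl
    | succ t ih =>
      rw [(hstep _ _ _ (hρ t)).1, ih]
      rcases Nat.mod_two_eq_zero_or_one t with h | h <;> simp [Nat.add_mod, h]
  have hI : ∀ k, ∃ i, u (2 * k) = .inl i := fun k =>
    (hstep _ _ _ (hρ (2 * k))).2.1 (by rw [hpar]; simp)
  have hO : ∀ k, ∃ o, u (2 * k + 1) = .inr o := fun k =>
    (hstep _ _ _ (hρ (2 * k + 1))).2.2 (by rw [hpar]; simp [Nat.add_mod])
  choose i hi using hI
  choose o ho using hO
  refine ⟨fun k => (i k, o k), funext fun t => ?_⟩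
  rcases Nat.even_or_odd' t with ⟨j, rfl | rfl⟩
  · rw [IOWord.letters_even, hi]
  · rw [IOWord.letters_odd, ho]

theorem assumptionAutomaton_recognises [Finite V] [Finite I] [Finite O] [Nonempty I] [Nonempty O]
    (hL : ∀ w, w ∈ L ↔ K.Accepting a₀ w)
    (hcoop : ∀ x ∈ (controller K N a₀ b₀ f pick).Out, ∀ w ∈ L, ∀ k, Agree w x k →
      ∃ y ∈ (controller K N a₀ b₀ f pick).Out ∩ L, Agree y x k) :
    (assumptionAutomaton K N a₀ b₀ f pick).Recognises
      (assumption (controller K N a₀ b₀ f pick) L) := by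
  ext u
  constructor
  · intro hu
    obtain ⟨w, rfl⟩ := exists_eq_letters_of_accepts hu
    refine ⟨w, ?_, rfl⟩
    obtain ⟨ρ, hρ, hacc⟩ := hu
    by_cases hw : w ∈ (controller K N a₀ b₀ f pick).Out
    · refine ⟨w, ⟨hw, (hL w).2 ?_⟩, Or.inl rfl⟩
      have hpath := fun t =>
        assumptionAutomaton_path_eq (k := t) hρ (fun j _ => hw j) t (by omega)
      obtain rfl := funext hpath
      exact hacc
    · obtain ⟨k, hk, hlt⟩ := exists_first_deviation hw
      obtain ⟨x, hx, hxw⟩ := exists_mem_out_agree hlt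
      have h1 := assumptionAutomaton_path_eq hρ hlt (2 * k + 1) le_rfl
      have h2 := hρ.2 (2 * k + 1)
      rw [controller_take] at hk
      have hlive : K.Live (K.posAt a₀ w (2 * k + 1)) := by
        rw [h1, IOWord.letters_odd] at h2
        simp only [assumptionAutomaton, Nat.mul_add_mod, Nat.one_mod, decide_true, if_neg hk] at h2
        split_ifs at h2 with hl
        convert hl using 1
        rw [posAt_odd]
      obtain ⟨v, hv1, hv2, hv3⟩ := hlive.exists_word
      have hvw : Agree v w k :=
        ⟨IOWord.take_eq_take_iff.2 fun j hj => hv1 j (by omega), hv2 k (by omega)⟩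
      obtain ⟨y, hy, hyx⟩ := hcoop x hx v ((hL v).2 hv3) k (hvw.trans hxw.symm)
      have hyw := hyx.trans hxw
      refine ⟨y, hy, Or.inr ⟨k, hyw.symm, ?_⟩⟩
      rwa [hy.1 k, hyw.1, hyw.2, controller_take]
  · rintro ⟨w, ⟨x, hx, rfl | ⟨k, hk, hne⟩⟩, rfl⟩
    · exact assumptionAutomaton_accepts_of_mem_out hx.1 ((hL w).1 hx.2)
    · refine assumptionAutomaton_accepts_of_live hx.1 hk hne ?_
      rw [posAt_congr hk]
      exact live_posAt ((hL x).1 hx.2) _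

/-- The automaton with its states renamed. -/
def ParityAutomaton.map {Q' : Type} (M : ParityAutomaton Q I O) (e : Q ≃ Q') :
    ParityAutomaton Q' I O where
  start := e M.start
  step s x := (M.step (e.symm s) x).map e
  colour s := M.colour (e.symm s)

theorem ParityAutomaton.Recognises.map {Q' : Type} {M : ParityAutomaton Q I O} (e : Q ≃ Q')
    (h : M.Recognises L) : (M.map e).Recognises L := by
  rw [Recognises, ← h]
  ext u
  constructor
  · rintro ⟨ρ, ⟨h0, hρ⟩, hacc⟩
    refine ⟨fun t => e.symm (ρ t), ⟨?_, fun t => ?_⟩, hacc⟩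
    · simp [h0, ParityAutomaton.map]
    · have := hρ t
      simp only [ParityAutomaton.map, Option.map_eq_some_iff] at this
      obtain ⟨s, h1, h2⟩ := this
      simp only [h1, ← h2, e.symm_apply_apply]
  · rintro ⟨ρ, ⟨h0, hρ⟩, hacc⟩
    refine ⟨fun t => e (ρ t), ⟨?_, fun t => ?_⟩, ?_⟩
    · simp [h0, ParityAutomaton.map]
    · simp [ParityAutomaton.map, hρ t]
    · simpa [AcceptingPath, ParityAutomaton.map] using hacc

end Automata

/-! ### The algorithm

States of completed automata are written as numbers, as in `ParityAutomaton.encodeTarget`, so that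
`0` is the rejecting state; an input `i` is the letter `i`, and an output `o` is the letter `p + o`.
The list `v` contains the code of an automaton from its entry `off` on. A positional strategy is
written as a number whose digits are its values. -/

section Algorithm

variable (p q : ℕ)

/-- The successor of the state `a` under the letter `x`. -/
def nextNum (v : List ℕ) (off a x : ℕ) : ℕ :=
  if a = 0 then 0 else v.getI (off + 2 + (a - 1) * (p + q + 1) + 1 + x)

/-- The colour of the state `a`. -/
def colNum (v : List ℕ) (off a : ℕ) : ℕ :=
  if a = 0 then 1 else v.getI (off + 2 + (a - 1) * (p + q + 1))

/-- The digit number `i` of `x` in base `B`. -/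
def digit (B x i : ℕ) : ℕ := x / B ^ i % B

/-- The state after `j` moves of the positional strategies `F` and `G`, from the state `a` at the
time `t`. -/
def runNum (v : List ℕ) (off F G t a j : ℕ) : ℕ :=
  Nat.rec a (fun j b => nextNum p q v off b
    (if (t + j) % 2 = 0 then digit p G b else p + digit q F b)) j

/-- The test for `CompleteAutomaton.Wins`. -/
def WinsNum (v : List ℕ) (off F G t a : ℕ) : Prop :=
  ∃ j < 2 * (2 * (v.getI off + 1)), 2 * (v.getI off + 1) ≤ j ∧
    colNum p q v off (runNum p q v off F G t a j) % 2 = 0 ∧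
    ∀ i < 2 * (2 * (v.getI off + 1)), 2 * (v.getI off + 1) ≤ i →
      colNum p q v off (runNum p q v off F G t a j) ≤
        colNum p q v off (runNum p q v off F G t a i)

/-- The test for `CompleteAutomaton.Live`, given the numbers `A` and `B` of positional strategies of
the two players. -/
def LiveNum (v : List ℕ) (off A B t a : ℕ) : Prop :=
  ∃ F < A, ∃ G < B, WinsNum p q v off F G t a

/-- The test for `CompleteAutomaton.Forced`. -/
def ForcedNum (v : List ℕ) (off A B t a : ℕ) : Prop :=
  ∃ F < A, ∀ G < B, WinsNum p q v off F G t a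

/-- The test for `CompleteAutomaton.Good`. -/
def GoodNum (v : List ℕ) (off A B F : ℕ) : Prop :=
  ∀ a < v.getI off + 1,
    (ForcedNum p q v off A B 1 a → ∀ G < B, WinsNum p q v off F G 1 a) ∧
    (LiveNum p q v off A B 1 a → ∃ G < B, WinsNum p q v off F G 1 a)

/-- Some good positional strategy. -/
noncomputable def goodNum (v : List ℕ) (off A B : ℕ) : ℕ := lastSat (GoodNum p q v off A B) A

/-- The function `choice`, for the positional strategy `F` of the specification, and for the
scenario that is written from the entry `off` on. -/
noncomputable def choiceNum (v : List ℕ) (off A B F a b : ℕ) : ℕ :=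
  open Classical in
  if ∃ o < q, LiveNum p q v off A B 0 (nextNum p q v off b (p + o)) then
    lastSat (fun o => LiveNum p q v off A B 0 (nextNum p q v off b (p + o))) q
  else digit q F a

/-- The number of the state `(t, a, b)` of the automaton of the assumption, where `n` is the number
of states of the specification. -/
def stateNum (n t a b : ℕ) : ℕ := t + 2 * (a + (n + 1) * b)

open Classical in
/-- The code of the transition of the automaton of the assumption from the state `(t, a, b)` under
the letter `x`. Here `n` and `m` are the numbers of states of the specification and of the scenario,
`A` and `B` are the numbers of positional strategies for the former, and `A'` and `B'` those for the
latter. The code of the scenario starts at the entry `off`. -/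
noncomputable def transNum (v : List ℕ) (n m off A B A' B' F t a b x : ℕ) : ℕ :=
  if x < p then
    if t = 0 then
      if b = m + 1 then stateNum n 1 a b + 1
      else stateNum n 1 (nextNum p q v 0 a x) (nextNum p q v off b x) + 1
    else 0
  else
    if t = 0 then 0
    else if b = m + 1 then stateNum n 0 a b + 1
    else if x = p + choiceNum p q v off A' B' F a b then
      stateNum n 0 (nextNum p q v 0 a x) (nextNum p q v off b x) + 1
    else if LiveNum p q v 0 A B 1 a then stateNum n 0 a (m + 1) + 1
    else 0

/-- The row of the code of the automaton of the assumption that describes the state `(t, a, b)`. -/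
noncomputable def rowNum (v : List ℕ) (n m off A B A' B' F t a b r : ℕ) : ℕ :=
  if r = 0 then (if b = m + 1 then 0 else colNum p q v 0 a)
  else transNum p q v n m off A B A' B' F t a b (r - 1)

/-- The number of states of the automaton of the assumption. -/
def sizeNum (n m : ℕ) : ℕ := 2 * ((n + 1) * (m + 2))

/-- The entry number `j` of the code of the automaton of the assumption. -/
noncomputable def entryNum (v : List ℕ) (n m off A B A' B' F j : ℕ) : ℕ :=
  if j = 0 then sizeNum n m
  else if j = 1 then stateNum n 0 (v.getI 1 + 1) (v.getI (off + 1) + 1)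
  else rowNum p q v n m off A B A' B' F ((j - 2) / (p + q + 1) % 2)
    ((j - 2) / (p + q + 1) / 2 % (n + 1)) ((j - 2) / (p + q + 1) / 2 / (n + 1))
    ((j - 2) % (p + q + 1))

/-! ### Its running time -/

variable {p q} {γ : Type} [Context γ] {v : γ → List ℕ} {off A B A' B' F G t a b x j n m : γ → ℕ}

open PolyComputable

theorem polyComputable_nextNum (hv : Readable v) (ho : PolyComputable off) (ha : PolyComputable a)
    (hx : PolyComputable x) : PolyComputable fun g => nextNum p q (v g) (off g) (a g) (x g) :=
  ite (.eq ha (const 0)) (const 0) (hv.getI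
    ((((ho.add (const 2)).add ((ha.sub (const 1)).mul (const (p + q + 1)))).add (const 1)).add hx))

theorem polyComputable_colNum (hv : Readable v) (ho : PolyComputable off) (ha : PolyComputable a) :
    PolyComputable fun g => colNum p q (v g) (off g) (a g) :=
  ite (.eq ha (const 0)) (const 1)
    (hv.getI ((ho.add (const 2)).add ((ha.sub (const 1)).mul (const (p + q + 1)))))

theorem polyComputable_digit (B : ℕ) (hx : PolyComputable x) (ha : PolyComputable a) :
    PolyComputable fun g => digit B (x g) (a g) := by
  have e : ∀ y i, Nat.rec (motive := fun _ => ℕ) y (fun _ r => r / B) i = y / B ^ i := fun y i => by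
    induction i with
    | zero => simp
    | succ i ih => simp only [ih, Nat.div_div_eq_div_mul, pow_succ]
  have h := natRec (s := fun x => x.2 / B) ha hx (var.div (const B)) hx.1 fun g i _ => by
    simp only [e]
    exact Nat.div_le_self _ _
  simp only [e] at h
  exact h.mod (const B)

theorem polyComputable_runNum (hv : Readable v) (ho : PolyComputable off) (hF : PolyComputable F)
    (hG : PolyComputable G) (ht : PolyComputable t) (ha : PolyComputable a)
    (hj : PolyComputable j) :
    PolyComputable fun g => runNum p q (v g) (off g) (F g) (G g) (t g) (a g) (j g) := by
  obtain ⟨B, hB, hvB⟩ := hv.2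
  have hd := ite (.eq ((ht.weaken.weaken.add var.weaken).mod (const 2)) (const 0))
    (polyComputable_digit p hG.weaken.weaken (var (γ := γ × ℕ)))
    ((const p).add (polyComputable_digit q hF.weaken.weaken (var (γ := γ × ℕ))))
  refine natRec hj ha (polyComputable_nextNum hv.weaken.weaken ho.weaken.weaken var hd)
    (ha.1.add hB) fun g i _ => ?_
  cases i with
  | zero => exact Nat.le_add_right _ _
  | succ i =>
    simp only [nextNum]
    split_ifs
    · exact Nat.zero_le _
    · exact (hvB _ _).trans (Nat.le_add_left _ _)
    · exact (hvB _ _).trans (Nat.le_add_left _ _)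

theorem polyDecidable_winsNum (hv : Readable v) (ho : PolyComputable off) (hF : PolyComputable F)
    (hG : PolyComputable G) (ht : PolyComputable t) (ha : PolyComputable a) :
    PolyDecidable fun g => WinsNum p q (v g) (off g) (F g) (G g) (t g) (a g) := by
  have hN := (const 2).mul (hv.getI ho).succ
  have hc := polyComputable_colNum (p := p) (q := q) hv.weaken ho.weaken
    (polyComputable_runNum (p := p) (q := q) hv.weaken ho.weaken hF.weaken hG.weaken ht.weaken
      ha.weaken var)
  have hc' := polyComputable_colNum (p := p) (q := q) hv.weaken.weaken ho.weaken.weaken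
    (polyComputable_runNum (p := p) (q := q) hv.weaken.weaken ho.weaken.weaken hF.weaken.weaken
      hG.weaken.weaken ht.weaken.weaken ha.weaken.weaken var)
  exact .exists_lt ((PolyDecidable.le hN.weaken var).and ((PolyDecidable.eq (hc.mod (const 2))
    (const 0)).and (.forall_lt ((PolyDecidable.le hN.weaken.weaken var).imp
      (.le hc.weaken hc')) ((const 2).mul hN).weaken))) ((const 2).mul hN)

theorem polyDecidable_liveNum (hv : Readable v) (ho : PolyComputable off) (hA : PolyComputable A)
    (hB : PolyComputable B) (ht : PolyComputable t) (ha : PolyComputable a) :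
    PolyDecidable fun g => LiveNum p q (v g) (off g) (A g) (B g) (t g) (a g) :=
  .exists_lt (.exists_lt (polyDecidable_winsNum hv.weaken.weaken ho.weaken.weaken var.weaken var
    ht.weaken.weaken ha.weaken.weaken) hB.weaken) hA

theorem polyDecidable_forcedNum (hv : Readable v) (ho : PolyComputable off) (hA : PolyComputable A)
    (hB : PolyComputable B) (ht : PolyComputable t) (ha : PolyComputable a) :
    PolyDecidable fun g => ForcedNum p q (v g) (off g) (A g) (B g) (t g) (a g) :=
  .exists_lt (.forall_lt (polyDecidable_winsNum hv.weaken.weaken ho.weaken.weaken var.weaken var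
    ht.weaken.weaken ha.weaken.weaken) hB.weaken) hA

theorem polyDecidable_goodNum (hv : Readable v) (ho : PolyComputable off) (hA : PolyComputable A)
    (hB : PolyComputable B) (hF : PolyComputable F) :
    PolyDecidable fun g => GoodNum p q (v g) (off g) (A g) (B g) (F g) := by
  have hw := polyDecidable_winsNum (p := p) (q := q) hv.weaken.weaken ho.weaken.weaken
    hF.weaken.weaken var (const 1) var.weaken
  exact .forall_lt (((polyDecidable_forcedNum hv.weaken ho.weaken hA.weaken hB.weaken (const 1)
    var).imp (.forall_lt hw hB.weaken)).and ((polyDecidable_liveNum hv.weaken ho.weaken hA.weaken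
      hB.weaken (const 1) var).imp (.exists_lt hw hB.weaken))) (hv.getI ho).succ

theorem polyComputable_goodNum (hv : Readable v) (ho : PolyComputable off) (hA : PolyComputable A)
    (hB : PolyComputable B) :
    PolyComputable fun g => goodNum p q (v g) (off g) (A g) (B g) :=
  .lastSat (polyDecidable_goodNum hv.weaken ho.weaken hA.weaken hB.weaken var) hA

theorem polyComputable_choiceNum (hv : Readable v) (ho : PolyComputable off)
    (hA : PolyComputable A) (hB : PolyComputable B) (hF : PolyComputable F) (ha : PolyComputable a)
    (hb : PolyComputable b) :
    PolyComputable fun g => choiceNum p q (v g) (off g) (A g) (B g) (F g) (a g) (b g) := by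
  have hl := polyDecidable_liveNum (p := p) (q := q) hv.weaken ho.weaken hA.weaken hB.weaken
    (const 0) (polyComputable_nextNum (p := p) (q := q) hv.weaken ho.weaken hb.weaken
      ((const p).add var))
  classical
  exact ite (.exists_lt hl (const q)) (.lastSat hl (const q)) (polyComputable_digit q hF ha)

theorem polyComputable_stateNum (hn : PolyComputable n) (ht : PolyComputable t)
    (ha : PolyComputable a) (hb : PolyComputable b) :
    PolyComputable fun g => stateNum (n g) (t g) (a g) (b g) :=
  ht.add ((const 2).mul (ha.add (hn.succ.mul hb)))

theorem polyComputable_transNum (hv : Readable v) (hn : PolyComputable n) (hm : PolyComputable m)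
    (ho : PolyComputable off) (hA : PolyComputable A) (hB : PolyComputable B)
    (hA' : PolyComputable A') (hB' : PolyComputable B') (hF : PolyComputable F)
    (ht : PolyComputable t) (ha : PolyComputable a) (hb : PolyComputable b)
    (hx : PolyComputable x) :
    PolyComputable fun g => transNum p q (v g) (n g) (m g) (off g) (A g) (B g) (A' g) (B' g) (F g)
      (t g) (a g) (b g) (x g) := by
  have ha' := polyComputable_nextNum (p := p) (q := q) hv (const 0) ha hx
  have hb' := polyComputable_nextNum (p := p) (q := q) hv ho hb hx
  have hsink := PolyDecidable.eq hb hm.succ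
  have h0 := PolyDecidable.eq ht (const 0)
  classical
  refine ite (.lt hx (const p)) (ite h0 (ite hsink (polyComputable_stateNum hn (const 1) ha hb).succ
    (polyComputable_stateNum hn (const 1) ha' hb').succ) (const 0)) (ite h0 (const 0)
      (ite hsink (polyComputable_stateNum hn (const 0) ha hb).succ (ite (.eq hx ((const p).add
        (polyComputable_choiceNum hv ho hA' hB' hF ha hb)))
        (polyComputable_stateNum hn (const 0) ha' hb').succ
        (ite (polyDecidable_liveNum hv (const 0) hA hB (const 1) ha)
          (polyComputable_stateNum hn (const 0) ha hm.succ).succ (const 0)))))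

theorem polyComputable_entryNum (hv : Readable v) (hn : PolyComputable n) (hm : PolyComputable m)
    (ho : PolyComputable off) (hA : PolyComputable A) (hB : PolyComputable B)
    (hA' : PolyComputable A') (hB' : PolyComputable B') (hF : PolyComputable F)
    (hj : PolyComputable j) :
    PolyComputable fun g => entryNum p q (v g) (n g) (m g) (off g) (A g) (B g) (A' g) (B' g) (F g)
      (j g) := by
  have hs := (hj.sub (const 2)).div (const (p + q + 1))
  have hr := (hj.sub (const 2)).mod (const (p + q + 1))
  have hb := (hs.div (const 2)).div hn.succ
  have ha := (hs.div (const 2)).mod hn.succ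
  exact ite (.eq hj (const 0)) ((const 2).mul (hn.succ.mul (hm.add (const 2))))
    (ite (.eq hj (const 1)) (polyComputable_stateNum hn (const 0) (hv.getI (const 1)).succ
      (hv.getI (ho.add (const 1))).succ)
    (ite (.eq hr (const 0)) (ite (.eq hb hm.succ) (const 0) (polyComputable_colNum hv (const 0) ha))
      (polyComputable_transNum hv hn hm ho hA hB hA' hB' hF (hs.mod (const 2)) ha hb
        (hr.sub (const 1)))))

theorem polyComputable_pow (p : ℕ) (hp : 0 < p) (hn : PolyComputable n)
    (h : PolyBdd fun g => p ^ n g) : PolyComputable fun g => p ^ n g := by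
  have e : ∀ i, Nat.rec (motive := fun _ => ℕ) 1 (fun _ r => r * p) i = p ^ i := fun i => by
    induction i with
    | zero => rfl
    | succ i ih => simp only [ih, pow_succ]
  exact (natRec (s := fun x => x.2 * p) hn (const 1) (var.mul (const p)) h fun g i hi => by
    simp only [e]; exact Nat.pow_le_pow_right hp hi).congr fun g => e _

end Algorithm

section Correctness

variable {n m p q : ℕ}

/-! ### Codes of automata -/

theorem getI_flatMap {α : Type} {h : α → List ℕ} {d : ℕ} (l : List α)
    (hd : ∀ x ∈ l, (h x).length = d) {s r : ℕ} (hs : s < l.length) (hr : r < d) :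
    (l.flatMap h).getI (s * d + r) = (h l[s]).getI r := by
  induction l generalizing s with
  | nil => simp at hs
  | cons x l ih =>
    have hx := hd x (List.mem_cons_self ..)
    rw [List.flatMap_cons]
    cases s with
    | zero => rw [Nat.zero_mul, Nat.zero_add, List.getI_append _ _ _ (by omega)]; rfl
    | succ s =>
      rw [Nat.succ_mul, List.getI_append_right _ _ _ (by omega), hx,
        show s * d + d + r - d = s * d + r by omega,
        ih (fun y hy => hd y (List.mem_cons_of_mem _ hy)) (by simpa using hs)]
      rfl

/-- The row of the code of an automaton that describes one state. -/
def ParityAutomaton.encodeRow (M : ParityAutomaton (Fin n) (Fin p) (Fin q)) (s : Fin n) : List ℕ :=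
  M.colour s :: ((List.finRange p).map fun i => encodeTarget (M.step s (Sum.inl i))) ++
    ((List.finRange q).map fun o => encodeTarget (M.step s (Sum.inr o)))

/-- Letters as numbers: first the inputs, then the outputs. -/
def letterNum : Fin p ⊕ Fin q → ℕ := Sum.elim (fun i => i) fun o => p + o

namespace ParityAutomaton

variable (M : ParityAutomaton (Fin n) (Fin p) (Fin q))

theorem length_encodeRow (s : Fin n) : (M.encodeRow s).length = p + q + 1 := by
  simp [encodeRow]

theorem getI_encodeRow_zero (s : Fin n) : (M.encodeRow s).getI 0 = M.colour s := rfl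

theorem getI_encodeRow_succ (s : Fin n) (x : Fin p ⊕ Fin q) :
    (M.encodeRow s).getI (1 + letterNum x) = encodeTarget (M.step s x) := by
  rw [encodeRow, Nat.add_comm 1, List.cons_append, List.getI_cons_succ]
  cases x with
  | inl i =>
    rw [letterNum, Sum.elim_inl, List.getI_append _ _ _ (by simp),
      List.getI_eq_getElem _ (by simp)]
    simp
  | inr o =>
    rw [letterNum, Sum.elim_inr, List.getI_append_right _ _ _ (by simp), List.length_map,
      List.length_finRange, Nat.add_sub_cancel_left, List.getI_eq_getElem _ (by simp)]
    simp

theorem encode_eq : M.encode = n :: (M.start : ℕ) :: (List.finRange n).flatMap M.encodeRow := rfl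

theorem length_encode : M.encode.length = 2 + n * (p + q + 1) := by
  have : ∀ l : List (Fin n), (l.flatMap M.encodeRow).length = l.length * (p + q + 1) := fun l => by
    simp [List.length_flatMap, length_encodeRow]
  rw [encode_eq, List.length_cons, List.length_cons, this, List.length_finRange]
  omega

theorem getI_encode (s : Fin n) {r : ℕ} (hr : r < p + q + 1) :
    M.encode.getI (2 + s * (p + q + 1) + r) = (M.encodeRow s).getI r := by
  rw [encode_eq, show 2 + (s : ℕ) * (p + q + 1) + r = (s * (p + q + 1) + r) + 1 + 1 by omega,
    List.getI_cons_succ, List.getI_cons_succ, getI_flatMap _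
      (fun s _ => M.length_encodeRow s) (by simp) hr]
  simp

end ParityAutomaton

theorem letterNum_lt (x : Fin p ⊕ Fin q) : letterNum x < p + q := by
  rcases x with i | o
  · have := i.2
    simp only [letterNum, Sum.elim_inl]
    omega
  · have := o.2
    simp only [letterNum, Sum.elim_inr]
    omega

theorem exists_letterNum_eq {x : ℕ} (hx : x < p + q) :
    ∃ y : Fin p ⊕ Fin q, letterNum y = x := by
  by_cases h : x < p
  · exact ⟨.inl ⟨x, h⟩, rfl⟩
  · exact ⟨.inr ⟨x - p, by omega⟩, by simp only [letterNum, Sum.elim_inr]; omega⟩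

/-- From its entry `off` on, the list `v` contains the code of the automaton `M`. -/
structure Codes (v : List ℕ) (off : ℕ) (M : ParityAutomaton (Fin n) (Fin p) (Fin q)) : Prop where
  size : v.getI off = n
  start : v.getI (off + 1) = M.start
  colour : ∀ s : Fin n, v.getI (off + 2 + s * (p + q + 1)) = M.colour s
  step : ∀ (s : Fin n) (x : Fin p ⊕ Fin q), v.getI (off + 2 + s * (p + q + 1) + 1 + letterNum x) =
    ParityAutomaton.encodeTarget (M.step s x)

theorem codes_append (M : ParityAutomaton (Fin n) (Fin p) (Fin q)) (u w : List ℕ) :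
    Codes (u ++ (M.encode ++ w)) u.length M := by
  have h : ∀ i < 2 + n * (p + q + 1),
      (u ++ (M.encode ++ w)).getI (u.length + i) = M.encode.getI i := fun i hi => by
    rw [List.getI_append_right _ _ _ (by omega), Nat.add_sub_cancel_left,
      List.getI_append _ _ _ (by rwa [M.length_encode])]
  have hlt : ∀ s : Fin n, s * (p + q + 1) + (p + q + 1) ≤ n * (p + q + 1) := fun s => by
    rw [← Nat.succ_mul]
    exact Nat.mul_le_mul_right _ s.2
  refine ⟨h 0 (by omega), h 1 (by omega), fun s => ?_, fun s x => ?_⟩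
  · have := hlt s
    rw [Nat.add_assoc, h _ (by omega), ← Nat.add_zero (2 + _), M.getI_encode s (by omega)]
    rfl
  · have := hlt s
    have hx := letterNum_lt x
    rw [show u.length + 2 + s * (p + q + 1) + 1 + letterNum x =
      u.length + (2 + s * (p + q + 1) + (1 + letterNum x)) by omega, h _ (by omega),
      M.getI_encode s (by omega), M.getI_encodeRow_succ]

open ParityAutomaton (encodeTarget)

theorem encodeTarget_injective : Function.Injective (encodeTarget (n := n)) := by
  rintro (_ | a) (_ | b) h <;> simp only [encodeTarget] at h
  · rfl
  · omega
  · omega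
  · rw [Fin.ext (show (a : ℕ) = b by omega)]

theorem encodeTarget_lt (a : Option (Fin n)) : encodeTarget a < n + 1 := by
  rcases a with _ | a <;> simp only [encodeTarget] <;> omega

theorem exists_encodeTarget_eq {c : ℕ} (hc : c < n + 1) :
    ∃ a : Option (Fin n), encodeTarget a = c := by
  cases c with
  | zero => exact ⟨none, rfl⟩
  | succ c => exact ⟨some ⟨c, by omega⟩, rfl⟩

/-! ### Correctness of the tests -/

section Tests

variable {v : List ℕ} {off : ℕ} {M : ParityAutomaton (Fin n) (Fin p) (Fin q)} (hp : 0 < p)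
  (hq : 0 < q)

theorem nextNum_eq (h : Codes v off M) (a : Option (Fin n)) (x : Fin p ⊕ Fin q) :
    nextNum p q v off (encodeTarget a) (letterNum x) = encodeTarget (M.complete.next a x) := by
  rcases a with _ | s
  · rfl
  · rw [nextNum, if_neg (show encodeTarget (some s) ≠ 0 from Nat.succ_ne_zero _),
      show encodeTarget (some s) - 1 = s from rfl, h.step]
    rfl

theorem nextNum_inl (h : Codes v off M) (a : Option (Fin n)) (i : Fin p) :
    nextNum p q v off (encodeTarget a) i = encodeTarget (M.complete.next a (.inl i)) :=
  nextNum_eq h a (.inl i)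

theorem nextNum_inr (h : Codes v off M) (a : Option (Fin n)) (o : Fin q) :
    nextNum p q v off (encodeTarget a) (p + o) = encodeTarget (M.complete.next a (.inr o)) :=
  nextNum_eq h a (.inr o)

theorem colNum_eq (h : Codes v off M) (a : Option (Fin n)) :
    colNum p q v off (encodeTarget a) = M.complete.col a := by
  rcases a with _ | s
  · rfl
  · rw [colNum, if_neg (show encodeTarget (some s) ≠ 0 from Nat.succ_ne_zero _),
      show encodeTarget (some s) - 1 = s from rfl, h.colour]
    rfl

/-- The positional strategy that is written as the number `F`. -/
def digitStrategy {B : ℕ} (hB : 0 < B) (F : ℕ) (a : Option (Fin n)) : Fin B :=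
  ⟨digit B F (encodeTarget a), Nat.mod_lt _ hB⟩

theorem exists_digit_eq {B : ℕ} (k : ℕ) (φ : ℕ → Fin B) :
    ∃ F < B ^ k, ∀ i < k, digit B F i = φ i := by
  induction k generalizing φ with
  | zero => exact ⟨0, by simp, by simp⟩
  | succ k ih =>
    obtain ⟨F, hF, h⟩ := ih fun i => φ (i + 1)
    have h0 := (φ 0).2
    have hB : 0 < B := by omega
    refine ⟨φ 0 + B * F, ?_, fun i hi => ?_⟩
    · calc φ 0 + B * F < B * (F + 1) := by rw [Nat.mul_succ]; omega
        _ ≤ B * B ^ k := Nat.mul_le_mul_left _ hF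
        _ = B ^ (k + 1) := by rw [pow_succ, Nat.mul_comm]
    · cases i with
      | zero => simp [digit, Nat.mod_eq_of_lt h0]
      | succ i =>
        rw [← h i (by omega), digit, digit, pow_succ', ← Nat.div_div_eq_div_mul,
          Nat.add_mul_div_left _ _ hB, Nat.div_eq_of_lt h0, Nat.zero_add]

theorem exists_digitStrategy_eq {B : ℕ} (hB : 0 < B) (f : Option (Fin n) → Fin B) :
    ∃ F < B ^ (n + 1), digitStrategy hB F = f := by
  obtain ⟨F, hF, h⟩ := exists_digit_eq (n + 1) (Function.extend encodeTarget f fun _ => f none)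
  refine ⟨F, hF, funext fun a => Fin.ext ?_⟩
  change digit B F (encodeTarget a) = _
  rw [h _ (encodeTarget_lt a), encodeTarget_injective.extend_apply]

theorem exists_lt_digitStrategy {B : ℕ} (hB : 0 < B) {P : (Option (Fin n) → Fin B) → Prop} :
    (∃ F < B ^ (n + 1), P (digitStrategy hB F)) ↔ ∃ f, P f := by
  constructor
  · rintro ⟨F, -, hF⟩
    exact ⟨_, hF⟩
  · rintro ⟨f, hf⟩
    obtain ⟨F, hF, rfl⟩ := exists_digitStrategy_eq hB f
    exact ⟨F, hF, hf⟩

theorem forall_lt_digitStrategy {B : ℕ} (hB : 0 < B) {P : (Option (Fin n) → Fin B) → Prop} :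
    (∀ F < B ^ (n + 1), P (digitStrategy hB F)) ↔ ∀ f, P f := by
  constructor
  · intro h f
    obtain ⟨F, hF, rfl⟩ := exists_digitStrategy_eq hB f
    exact h F hF
  · intro h F _
    exact h _

variable (F G : ℕ)

theorem runNum_eq (h : Codes v off M) (b : Bool) (a : Option (Fin n)) (j : ℕ) :
    runNum p q v off F G b.toNat (encodeTarget a) j = encodeTarget
      ((M.complete.follow (digitStrategy hq F) (digitStrategy hp G))^[j] (b, a)).2 ∧
    ((M.complete.follow (digitStrategy hq F) (digitStrategy hp G))^[j] (b, a)).1 =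
      decide ((b.toNat + j) % 2 = 1) := by
  induction j with
  | zero => cases b <;> exact ⟨rfl, rfl⟩
  | succ j ih =>
    rw [Function.iterate_succ_apply']
    generalize (M.complete.follow (digitStrategy hq F) (digitStrategy hp G))^[j] (b, a) = w at ih
    obtain ⟨ih1, ih2⟩ := ih
    refine ⟨?_, ?_⟩
    · change nextNum p q v off (runNum p q v off F G b.toNat (encodeTarget a) j)
        (if (b.toNat + j) % 2 = 0 then digit p G (runNum p q v off F G b.toNat (encodeTarget a) j)
          else p + digit q F (runNum p q v off F G b.toNat (encodeTarget a) j)) = _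
      rw [ih1]
      rcases Nat.mod_two_eq_zero_or_one (b.toNat + j) with hj | hj
      · rw [if_pos hj]
        simp only [hj, zero_ne_one, decide_false] at ih2
        simp only [follow, move, ih2, Bool.false_eq_true, if_false]
        exact nextNum_inl h w.2 (digitStrategy hp G w.2)
      · rw [if_neg (by omega)]
        simp only [hj, decide_true] at ih2
        simp only [follow, move, ih2, if_true]
        exact nextNum_inr h w.2 (digitStrategy hq F w.2)
    · rw [follow, move, ih2]
      rcases Nat.mod_two_eq_zero_or_one (b.toNat + j) with hj | hj
      · simp [hj, show (b.toNat + (j + 1)) % 2 = 1 by omega]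
      · simp [hj, show (b.toNat + (j + 1)) % 2 = 0 by omega]

theorem winsNum_iff (h : Codes v off M) (b : Bool) (a : Option (Fin n)) :
    WinsNum p q v off F G b.toNat (encodeTarget a) ↔
      M.complete.Wins (digitStrategy hq F) (digitStrategy hp G) (b, a) := by
  have hN : Fintype.card (Bool × Option (Fin n)) ≤ 2 * (n + 1) := by simp
  have h1 := parityAccepting_iterate_iff (fun w : Bool × Option (Fin n) => M.complete.col w.2)
    (M.complete.follow (digitStrategy hq F) (digitStrategy hp G)) (b, a) hN
  rw [Wins, h1]
  simp only [WinsNum, h.size, (runNum_eq hp hq F G h b a _).1, colNum_eq h, Nat.even_iff]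

theorem liveNum_iff (h : Codes v off M) (hp : 0 < p) (hq : 0 < q) (b : Bool) (a : Option (Fin n)) :
    LiveNum p q v off (q ^ (n + 1)) (p ^ (n + 1)) b.toNat (encodeTarget a) ↔
      M.complete.Live (b, a) := by
  simp only [LiveNum, Live, winsNum_iff hp hq _ _ h]
  rw [exists_lt_digitStrategy hq (P := fun f => ∃ G < p ^ (n + 1),
    M.complete.Wins f (digitStrategy hp G) (b, a))]
  exact exists_congr fun f =>
    exists_lt_digitStrategy hp (P := fun g => M.complete.Wins f g (b, a))

theorem forcedNum_iff (h : Codes v off M) (hp : 0 < p) (hq : 0 < q) (b : Bool)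
    (a : Option (Fin n)) :
    ForcedNum p q v off (q ^ (n + 1)) (p ^ (n + 1)) b.toNat (encodeTarget a) ↔
      M.complete.Forced (b, a) := by
  simp only [ForcedNum, Forced, winsNum_iff hp hq _ _ h]
  rw [exists_lt_digitStrategy hq (P := fun f => ∀ G < p ^ (n + 1),
    M.complete.Wins f (digitStrategy hp G) (b, a))]
  exact exists_congr fun f =>
    forall_lt_digitStrategy hp (P := fun g => M.complete.Wins f g (b, a))

theorem goodNum_iff (h : Codes v off M) (hp : 0 < p) :
    GoodNum p q v off (q ^ (n + 1)) (p ^ (n + 1)) F ↔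
    M.complete.Good (digitStrategy hq F) := by
  have h1 : ∀ a : Option (Fin n),
      ((ForcedNum p q v off (q ^ (n + 1)) (p ^ (n + 1)) 1 (encodeTarget a) →
        ∀ G < p ^ (n + 1), WinsNum p q v off F G 1 (encodeTarget a)) ∧
      (LiveNum p q v off (q ^ (n + 1)) (p ^ (n + 1)) 1 (encodeTarget a) →
        ∃ G < p ^ (n + 1), WinsNum p q v off F G 1 (encodeTarget a))) ↔
      (M.complete.Forced (true, a) → ∀ g, M.complete.Wins (digitStrategy hq F) g (true, a)) ∧
      (M.complete.Live (true, a) → ∃ g, M.complete.Wins (digitStrategy hq F) g (true, a)) := by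
    intro a
    have e1 := forcedNum_iff h hp hq true a
    have e2 := liveNum_iff h hp hq true a
    have e3 := fun G => winsNum_iff hp hq F G h true a
    simp only [Bool.toNat_true] at e1 e2 e3
    rw [← forall_lt_digitStrategy hp, ← exists_lt_digitStrategy hp, e1, e2]
    simp only [e3]
  rw [GoodNum, Good, h.size]
  constructor
  · intro hg a
    exact (h1 a).1 (hg _ (encodeTarget_lt a))
  · intro hg c hc
    obtain ⟨a, rfl⟩ := exists_encodeTarget_eq hc
    exact (h1 a).2 (hg a)

/-- The search succeeds, since every positional strategy is written as some number in its range. -/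
theorem good_goodNum (h : Codes v off M) (hp : 0 < p) :
    M.complete.Good (digitStrategy hq (goodNum p q v off (q ^ (n + 1)) (p ^ (n + 1)))) := by
  have : Nonempty (Fin p) := ⟨⟨0, hp⟩⟩
  have : Nonempty (Fin q) := ⟨⟨0, hq⟩⟩
  rw [← goodNum_iff hq _ h hp]
  refine lastSat_spec ?_
  obtain ⟨f, hf⟩ := M.complete.exists_good
  obtain ⟨F, hF, rfl⟩ := exists_digitStrategy_eq hq f
  exact ⟨F, hF, (goodNum_iff hq F h hp).2 hf⟩

/-- The last output that keeps the scenario possible. -/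
noncomputable def lastLive (hq : 0 < q) (M : ParityAutomaton (Fin n) (Fin p) (Fin q))
    (b : Option (Fin n)) : Fin q :=
  ⟨lastSat (fun o => ∃ o' : Fin q, (o' : ℕ) = o ∧
    M.complete.Live (false, M.complete.next b (.inr o'))) q, lastSat_lt _ hq⟩

theorem live_lastLive (b : Option (Fin n))
    (hb : ∃ o, M.complete.Live (false, M.complete.next b (.inr o))) :
    M.complete.Live (false, M.complete.next b (.inr (lastLive hq M b))) := by
  obtain ⟨o, ho⟩ := hb
  obtain ⟨o', h1, h2⟩ := lastSat_spec (n := q) (P := fun o => ∃ o' : Fin q, (o' : ℕ) = o ∧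
    M.complete.Live (false, M.complete.next b (.inr o'))) ⟨o, o.2, o, rfl, ho⟩
  have : lastLive hq M b = o' := Fin.ext h1.symm
  rwa [this]

theorem lastSat_congr {P Q : ℕ → Prop} {k : ℕ} (h : ∀ i < k, P i ↔ Q i) :
    lastSat P k = lastSat Q k := by
  classical
  induction k with
  | zero => rfl
  | succ k ih =>
    rw [lastSat_succ, lastSat_succ, ih fun i hi => h i (by omega)]
    simp only [h k (by omega)]

/-- Where the scenario requires an output, the search finds the one that `lastLive` names; elsewhere
both sides follow the positional strategy. -/
theorem choiceNum_eq (h : Codes v off M) (hp : 0 < p) {l : ℕ} (a : Option (Fin l))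
    (b : Option (Fin n)) :
    choiceNum p q v off (q ^ (n + 1)) (p ^ (n + 1)) F (encodeTarget a) (encodeTarget b) =
      choice M.complete (digitStrategy hq F) (lastLive hq M) a b := by
  have e : ∀ o < q, LiveNum p q v off (q ^ (n + 1)) (p ^ (n + 1)) 0
      (nextNum p q v off (encodeTarget b) (p + o)) ↔ ∃ o' : Fin q, (o' : ℕ) = o ∧
        M.complete.Live (false, M.complete.next b (.inr o')) := fun o ho => by
    have h1 := nextNum_inr h b ⟨o, ho⟩
    simp only at h1
    rw [h1]
    have h2 := liveNum_iff h hp hq false (M.complete.next b (.inr ⟨o, ho⟩))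
    rw [Bool.toNat_false] at h2
    rw [h2]
    constructor
    · intro hl
      exact ⟨⟨o, ho⟩, rfl, hl⟩
    · rintro ⟨o', rfl, hl⟩
      exact hl
  have e' : (∃ o < q, LiveNum p q v off (q ^ (n + 1)) (p ^ (n + 1)) 0
      (nextNum p q v off (encodeTarget b) (p + o))) ↔
      ∃ o, M.complete.Live (false, M.complete.next b (.inr o)) := by
    constructor
    · rintro ⟨o, ho, hl⟩
      obtain ⟨o', -, hl'⟩ := (e o ho).1 hl
      exact ⟨o', hl'⟩
    · rintro ⟨o, hl⟩
      exact ⟨o, o.2, (e o o.2).2 ⟨o, rfl, hl⟩⟩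
  rw [choiceNum, choice]
  by_cases hc : ∃ o, M.complete.Live (false, M.complete.next b (.inr o))
  · rw [if_pos (e'.2 hc), if_pos hc, lastLive]
    exact lastSat_congr e
  · rw [if_neg (mt e'.1 hc), if_neg hc]
    rfl

end Tests

/-! ### Correctness of the output -/

/-- The code of a state of the automaton of the scenario, or of the accepting sink. -/
def encodeSink (b : Option (Option (Fin m))) : ℕ := b.elim (m + 1) encodeTarget

theorem encodeSink_injective : Function.Injective (encodeSink (m := m)) := by
  rintro (_ | a) (_ | b) h <;> simp only [encodeSink, Option.elim] at h
  · rfl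
  · have := encodeTarget_lt b; omega
  · have := encodeTarget_lt a; omega
  · rw [encodeTarget_injective h]

theorem encodeSink_lt (b : Option (Option (Fin m))) : encodeSink b < m + 2 := by
  rcases b with _ | b
  · exact Nat.lt_succ_self _
  · exact (encodeTarget_lt b).trans (Nat.lt_succ_self _)

theorem stateNum_lt {n m t a b : ℕ} (ht : t < 2) (ha : a < n + 1) (hb : b < m + 2) :
    stateNum n t a b < sizeNum n m := by
  have : (n + 1) * b + (n + 1) ≤ (n + 1) * (m + 2) := by
    rw [← Nat.mul_succ]
    exact Nat.mul_le_mul_left _ hb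
  rw [stateNum, sizeNum]
  omega

theorem stateNum_mod {n t a b : ℕ} (ht : t < 2) : stateNum n t a b % 2 = t := by
  rw [stateNum]
  omega

theorem stateNum_div_mod {n t a b : ℕ} (ht : t < 2) (ha : a < n + 1) :
    stateNum n t a b / 2 % (n + 1) = a := by
  rw [stateNum, show (t + 2 * (a + (n + 1) * b)) / 2 = a + (n + 1) * b by omega,
    Nat.add_mul_mod_self_left, Nat.mod_eq_of_lt ha]

theorem stateNum_div_div {n t a b : ℕ} (ht : t < 2) (ha : a < n + 1) :
    stateNum n t a b / 2 / (n + 1) = b := by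
  rw [stateNum, show (t + 2 * (a + (n + 1) * b)) / 2 = a + (n + 1) * b by omega,
    Nat.add_mul_div_left _ _ (Nat.succ_pos n), Nat.div_eq_of_lt ha, Nat.zero_add]

theorem bool_toNat_lt (b : Bool) : b.toNat < 2 := by cases b <;> decide

/-- The numbering of the states of the automaton of the assumption. -/
noncomputable def stateEquiv (n m : ℕ) :
    Bool × Option (Fin n) × Option (Option (Fin m)) ≃ Fin (sizeNum n m) :=
  Equiv.ofBijective
    (fun s => ⟨stateNum n s.1.toNat (encodeTarget s.2.1) (encodeSink s.2.2),
      stateNum_lt (bool_toNat_lt _) (encodeTarget_lt _) (encodeSink_lt _)⟩) <| by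
    rw [Fintype.bijective_iff_injective_and_card]
    constructor
    · rintro ⟨t, a, b⟩ ⟨t', a', b'⟩ h
      have h := congrArg Fin.val h
      simp only at h
      have ht := congrArg (· % 2) h
      have ha := congrArg (· / 2 % (n + 1)) h
      have hb := congrArg (· / 2 / (n + 1)) h
      simp only [stateNum_mod (bool_toNat_lt _)] at ht
      simp only [stateNum_div_mod (bool_toNat_lt _) (encodeTarget_lt _)] at ha
      simp only [stateNum_div_div (bool_toNat_lt _) (encodeTarget_lt _)] at hb
      rw [encodeTarget_injective ha, encodeSink_injective hb]
      cases t <;> cases t' <;> simp at ht ⊢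
    · rw [Fintype.card_fin, sizeNum]
      simp only [Fintype.card_prod, Fintype.card_bool, Fintype.card_option, Fintype.card_fin]

theorem stateEquiv_apply (t : Bool) (a : Option (Fin n)) (b : Option (Option (Fin m))) :
    (stateEquiv n m (t, a, b) : ℕ) = stateNum n t.toNat (encodeTarget a) (encodeSink b) := rfl

variable (hq : 0 < q) (ML : ParityAutomaton (Fin n) (Fin p) (Fin q))
  (MS : ParityAutomaton (Fin m) (Fin p) (Fin q))

/-- The automaton that the algorithm writes down, when it uses the positional strategy `F`. -/
noncomputable def outputAutomaton (F : ℕ) :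
    ParityAutomaton (Fin (sizeNum n m)) (Fin p) (Fin q) :=
  (assumptionAutomaton ML.complete MS.complete (some ML.start) (some MS.start)
    (digitStrategy hq F) (lastLive hq MS)).map (stateEquiv n m)

variable {ML MS} {v : List ℕ} {off F : ℕ}

theorem transNum_eq (hp : 0 < p) (hL : Codes v 0 ML) (hS : Codes v off MS) (t : Bool)
    (a : Option (Fin n)) (b : Option (Option (Fin m))) (x : Fin p ⊕ Fin q) :
    transNum p q v n m off (q ^ (n + 1)) (p ^ (n + 1)) (q ^ (m + 1)) (p ^ (m + 1)) F t.toNat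
      (encodeTarget a) (encodeSink b) (letterNum x) =
    encodeTarget ((outputAutomaton hq ML MS F).step (stateEquiv n m (t, a, b)) x) := by
  have hb : ∀ b : Option (Fin m), encodeTarget b ≠ m + 1 := fun b =>
    (encodeTarget_lt b).ne
  rw [transNum, outputAutomaton]
  simp only [ParityAutomaton.map, Equiv.symm_apply_apply]
  rcases x with i | o
  · rw [letterNum, Sum.elim_inl, if_pos i.2]
    cases t
    · rcases b with _ | b
      · simp [assumptionAutomaton, encodeSink, encodeTarget, stateEquiv_apply]
      · simp [assumptionAutomaton, encodeSink, hb, nextNum_inl hL, nextNum_inl hS]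
        rfl
    · simp [assumptionAutomaton, encodeTarget]
  · rw [letterNum, Sum.elim_inr, if_neg (by omega)]
    cases t
    · simp [assumptionAutomaton, encodeTarget]
    · rcases b with _ | b
      · simp [assumptionAutomaton, encodeSink, encodeTarget, stateEquiv_apply]
      · have hl := liveNum_iff hL hp hq true a
        rw [Bool.toNat_true] at hl
        simp only [Bool.toNat_true, one_ne_zero, if_false, encodeSink, Option.elim, hb,
          choiceNum_eq hq F hS hp, Nat.add_left_cancel_iff, nextNum_inr hL, nextNum_inr hS, hl,
          assumptionAutomaton, ← Fin.ext_iff]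
        split_ifs <;> first | rfl | exact absurd (hl.1 ‹_›) ‹_› | exact absurd (hl.2 ‹_›) ‹_›

theorem rowNum_zero_eq (hL : Codes v 0 ML) (A B A' B' : ℕ) (t : Bool) (a : Option (Fin n))
    (b : Option (Option (Fin m))) :
    rowNum p q v n m off A B A' B' F t.toNat (encodeTarget a) (encodeSink b) 0 =
      (outputAutomaton hq ML MS F).colour (stateEquiv n m (t, a, b)) := by
  rw [rowNum, if_pos rfl, outputAutomaton]
  simp only [ParityAutomaton.map, Equiv.symm_apply_apply]
  rcases b with _ | b
  · simp [encodeSink, assumptionAutomaton]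
  · simp only [encodeSink, Option.elim, (encodeTarget_lt b).ne, if_false, colNum_eq hL]
    rfl

/-- The numbers computed by the algorithm are the entries of the code of the automaton. -/
theorem map_entryNum_eq (hp : 0 < p) (hL : Codes v 0 ML) (hS : Codes v off MS) :
    (List.range (2 + sizeNum n m * (p + q + 1))).map
      (entryNum p q v n m off (q ^ (n + 1)) (p ^ (n + 1)) (q ^ (m + 1)) (p ^ (m + 1)) F) =
    (outputAutomaton hq ML MS F).encode := by
  set M := outputAutomaton hq ML MS F with hM
  refine List.ext_getElem (by rw [M.length_encode]; simp) fun j hj hj' => ?_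
  rw [List.getElem_map, List.getElem_range, ← List.getI_eq_getElem]
  rw [M.length_encode] at hj'
  rcases j with _ | _ | j
  · rfl
  · rw [entryNum, if_neg (by omega), if_pos rfl, hS.start, hL.start]
    rfl
  · have hd : 0 < p + q + 1 := Nat.succ_pos _
    have hs : j / (p + q + 1) < sizeNum n m := (Nat.div_lt_iff_lt_mul hd).2 (by omega)
    have hr : j % (p + q + 1) < p + q + 1 := Nat.mod_lt _ hd
    have hj2 : j + 1 + 1 = 2 + (⟨j / (p + q + 1), hs⟩ : Fin (sizeNum n m)) * (p + q + 1) +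
        j % (p + q + 1) := by
      have := Nat.div_add_mod' j (p + q + 1)
      simp only
      omega
    conv_rhs => rw [hj2, M.getI_encode _ hr]
    rw [entryNum, if_neg (by omega), if_neg (by omega), show j + 1 + 1 - 2 = j by omega]
    obtain ⟨⟨t, a, b⟩, hst⟩ := (stateEquiv n m).surjective ⟨j / (p + q + 1), hs⟩
    rw [← hst]
    have hval : j / (p + q + 1) = stateNum n t.toNat (encodeTarget a) (encodeSink b) :=
      (congrArg Fin.val hst).symm
    rw [hval, stateNum_mod (bool_toNat_lt t),
      stateNum_div_mod (bool_toNat_lt t) (encodeTarget_lt a),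
      stateNum_div_div (bool_toNat_lt t) (encodeTarget_lt a)]
    rcases hr0 : j % (p + q + 1) with _ | r
    · rw [M.getI_encodeRow_zero, rowNum_zero_eq hq hL]
    · obtain ⟨x, rfl⟩ := exists_letterNum_eq (p := p) (q := q) (x := r) (by omega)
      rw [rowNum, if_neg (by omega), Nat.add_sub_cancel, Nat.add_comm (letterNum x) 1,
        M.getI_encodeRow_succ, transNum_eq hq hp hL hS]

end Correctness

/-! ### Sizes of codes -/

theorem bitSize_cons (x : ℕ) (l : List ℕ) : bitSize (x :: l) = Nat.size x + 1 + bitSize l := by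
  simp [bitSize]

theorem sum_lt_two_pow_bitSize (l : List ℕ) : l.sum < 2 ^ bitSize l := by
  induction l with
  | nil => simp [bitSize]
  | cons x l ih =>
    have h1 : x < 2 ^ Nat.size x := Nat.lt_size_self x
    rw [List.sum_cons, bitSize_cons, pow_add, pow_succ]
    calc x + l.sum < 2 ^ Nat.size x + 2 ^ bitSize l := by omega
      _ ≤ 2 ^ Nat.size x * 2 * 2 ^ bitSize l := by
        have := Nat.mul_le_mul h1.pos (Nat.one_le_two_pow (n := bitSize l))
        nlinarith [h1.pos, Nat.one_le_two_pow (n := bitSize l)]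

theorem length_le_bitSize (l : List ℕ) : l.length ≤ bitSize l := by
  induction l with
  | nil => simp
  | cons x l ih =>
    rw [bitSize_cons, List.length_cons]
    omega

theorem bitSize_le {l : List ℕ} {k : ℕ} (h : ∀ x ∈ l, x < 2 ^ k) :
    bitSize l ≤ l.length * (k + 1) := by
  induction l with
  | nil => simp [bitSize]
  | cons x l ih =>
    have h1 := ih fun y hy => h y (List.mem_cons_of_mem _ hy)
    have h2 := Nat.size_le.2 (h x (List.mem_cons_self ..))
    rw [bitSize_cons, List.length_cons, Nat.succ_mul]
    omega

theorem ParityAutomaton.le_of_mem_encode {n p q c : ℕ}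
    {M : ParityAutomaton (Fin n) (Fin p) (Fin q)} (hn : n ≤ c) (hc : ∀ s, M.colour s ≤ c) {x : ℕ}
    (hx : x ∈ M.encode) : x ≤ c := by
  have ht : ∀ a : Option (Fin n), encodeTarget a ≤ c := fun a =>
    (Nat.le_of_lt_succ (encodeTarget_lt a)).trans hn
  simp only [encode, List.mem_cons, List.mem_flatMap, List.cons_append, List.mem_append,
    List.mem_map] at hx
  rcases hx with rfl | rfl | ⟨s, -, rfl | ⟨i, -, rfl⟩ | ⟨o, -, rfl⟩⟩
  · exact hn
  · exact M.start.2.le.trans hn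
  · exact hc s
  · exact ht _
  · exact ht _

theorem ParityAutomaton.colour_mem_encode {n p q : ℕ}
    (M : ParityAutomaton (Fin n) (Fin p) (Fin q)) (s : Fin n) : M.colour s ∈ M.encode := by
  simp only [encode, List.mem_cons, List.mem_flatMap, List.cons_append]
  exact Or.inr (Or.inr ⟨s, List.mem_finRange s, Or.inl rfl⟩)

/-! ### Inputs of the algorithm -/

/-- Automata of a specification and of a scenario. -/
structure AutomataPair (p q : ℕ) where
  /-- The number of states of the first automaton. -/
  n : ℕ
  /-- The number of states of the second automaton. -/
  m : ℕ
  spec : ParityAutomaton (Fin n) (Fin p) (Fin q)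
  scen : ParityAutomaton (Fin m) (Fin p) (Fin q)

namespace AutomataPair

variable {p q : ℕ} (g : AutomataPair p q)

/-- The input of the algorithm. -/
def code : List ℕ := g.spec.encode ++ g.scen.encode

/-- The place where the code of the scenario starts. -/
def offset : ℕ := 2 + g.n * (p + q + 1)

/-- The positional strategy that the algorithm uses. -/
noncomputable def strategy : ℕ := goodNum p q g.code 0 (q ^ (g.n + 1)) (p ^ (g.n + 1))

/-- The output of the algorithm, entry by entry. -/
noncomputable def entry (j : ℕ) : ℕ :=
  entryNum p q g.code g.n g.m g.offset (q ^ (g.n + 1)) (p ^ (g.n + 1)) (q ^ (g.m + 1))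
    (p ^ (g.m + 1)) g.strategy j

/-- The length of the output of the algorithm. -/
def outputLength : ℕ := 2 + sizeNum g.n g.m * (p + q + 1)

/-- The budget allows the algorithm to enumerate positional strategies of both automata, and to hold
its output in a single number. -/
noncomputable instance : Context (AutomataPair p q) where
  enc := code
  budget g := g.code.sum + (q ^ (g.n + 1) + p ^ (g.n + 1) + q ^ (g.m + 1) + p ^ (g.m + 1)) +
    (∑ i ∈ Finset.range g.outputLength, g.entry i + 1) ^ g.outputLength

theorem codes_spec : Codes g.code 0 g.spec := codes_append g.spec [] g.scen.encode

theorem codes_scen : Codes g.code g.offset g.scen := by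
  have h := codes_append g.scen g.spec.encode []
  rwa [List.append_nil, g.spec.length_encode] at h

theorem map_entry (hp : 0 < p) (hq : 0 < q) : (List.range g.outputLength).map g.entry =
    (outputAutomaton hq g.spec g.scen g.strategy).encode :=
  map_entryNum_eq hq hp g.codes_spec g.codes_scen

theorem polyComputableList_map_entry (hp : 0 < p) (hq : 0 < q) :
    PolyComputableList fun g : AutomataPair p q => (List.range g.outputLength).map g.entry := by
  open PolyComputable in
  have hv : Readable (code (p := p) (q := q)) := .enc fun g x hx =>
    (List.le_sum_of_mem hx).trans ((Nat.le_add_right _ _).trans (Nat.le_add_right _ _))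
  have hn : PolyComputable (n (p := p) (q := q)) :=
    (hv.getI (const 0)).congr fun g => g.codes_spec.size
  have ho : PolyComputable (offset (p := p) (q := q)) := (const 2).add (hn.mul (const (p + q + 1)))
  have hm : PolyComputable (m (p := p) (q := q)) := (hv.getI ho).congr fun g => g.codes_scen.size
  have hb : ∀ {f : AutomataPair p q → ℕ}, (∀ g : AutomataPair p q,
      f g ≤ q ^ (g.n + 1) + p ^ (g.n + 1) + q ^ (g.m + 1) + p ^ (g.m + 1)) → PolyBdd f := fun h =>
    PolyBdd.budget.mono fun g =>
      (h g).trans ((Nat.le_add_left _ _).trans (Nat.le_add_right _ _))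
  have hA := polyComputable_pow q hq hn.succ (hb fun g => by omega)
  have hB := polyComputable_pow p hp hn.succ (hb fun g => by omega)
  have hA' := polyComputable_pow q hq hm.succ (hb fun g => by omega)
  have hB' := polyComputable_pow p hp hm.succ (hb fun g => by omega)
  have hF : PolyComputable (strategy (p := p) (q := q)) :=
    polyComputable_goodNum hv (const 0) hA hB
  refine .map_range ((const 2).add (((const 2).mul (hn.succ.mul (hm.add (const 2)))).mul
    (const (p + q + 1)))) (polyComputable_entryNum hv.weaken hn.weaken hm.weaken ho.weaken hA.weaken
    hB.weaken hA'.weaken hB'.weaken hF.weaken var) PolyBdd.budget fun g => Nat.le_add_left _ _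

/-! ### Bounds by the size of the input -/

theorem add_four_le_bitSize : g.n + g.m + 4 ≤ bitSize g.code := by
  have h := length_le_bitSize g.code
  rw [code, List.length_append, g.spec.length_encode, g.scen.length_encode, ← code] at h
  have h1 := Nat.le_mul_of_pos_right g.n (Nat.succ_pos (p + q))
  have h2 := Nat.le_mul_of_pos_right g.m (Nat.succ_pos (p + q))
  simp only [Nat.succ_eq_add_one] at h1 h2
  omega

theorem sizeNum_le : sizeNum g.n g.m ≤ 2 * bitSize g.code ^ 2 := by
  have h := g.add_four_le_bitSize
  rw [sizeNum, pow_two]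
  exact Nat.mul_le_mul_left _ (Nat.mul_le_mul (by omega) (by omega))

theorem outputLength_le :
    g.outputLength ≤ 2 + 2 * bitSize g.code ^ 2 * (p + q + 1) :=
  Nat.add_le_add_left (Nat.mul_le_mul_right _ g.sizeNum_le) _

theorem colour_outputAutomaton_le (hq : 0 < q) (s : Fin (sizeNum g.n g.m)) :
    (outputAutomaton hq g.spec g.scen g.strategy).colour s ≤ g.code.sum + 1 := by
  rw [outputAutomaton]
  simp only [ParityAutomaton.map]
  rcases (stateEquiv g.n g.m).symm s with ⟨t, _ | a, _ | b⟩
  · exact Nat.zero_le _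
  · exact Nat.le_add_left _ _
  · exact Nat.zero_le _
  · exact (List.le_sum_of_mem (List.mem_append_left _ (g.spec.colour_mem_encode a))).trans
      (Nat.le_succ _)

/-- The bound for the size of the output. -/
noncomputable def sizeBound (p q : ℕ) : Polynomial ℕ :=
  open Polynomial in (C 2 + C 2 * X ^ 2 * C (p + q + 1)) * (C 2 * X + C 2)

theorem bitSize_output_le (hq : 0 < q) :
    bitSize (outputAutomaton hq g.spec g.scen g.strategy).encode ≤
      (sizeBound p q).eval (bitSize g.code) := by
  set s := bitSize g.code with hs
  -- Every entry of the output is at most the number of states or a colour of the specification.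
  have h1 : sizeNum g.n g.m < 2 ^ (2 * s + 1) := by
    have h2 : s < 2 ^ s := Nat.lt_two_pow_self
    calc sizeNum g.n g.m ≤ 2 * s ^ 2 := g.sizeNum_le
      _ < 2 * (2 ^ s) ^ 2 := Nat.mul_lt_mul_of_pos_left (Nat.pow_lt_pow_left h2 two_ne_zero) two_pos
      _ = 2 ^ (2 * s + 1) := by ring
  have h2 : g.code.sum + 1 < 2 ^ (2 * s + 1) := by
    have h3 := sum_lt_two_pow_bitSize g.code
    rw [← hs] at h3
    refine (Nat.succ_le_of_lt h3).trans_lt (Nat.pow_lt_pow_right one_lt_two (by omega))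
  have h4 := bitSize_le (l := (outputAutomaton hq g.spec g.scen g.strategy).encode)
    (k := 2 * s + 1) fun x hx => (ParityAutomaton.le_of_mem_encode (le_max_left _ _)
      (fun s => (g.colour_outputAutomaton_le hq s).trans (le_max_right _ _)) hx).trans_lt
      (max_lt h1 h2)
  rw [ParityAutomaton.length_encode] at h4
  refine h4.trans ((Nat.mul_le_mul_right _ g.outputLength_le).trans_eq ?_)
  simp [sizeBound, ← hs]

theorem pow_le_two_pow_mul (b k : ℕ) : b ^ k ≤ 2 ^ (b * k) := by
  rw [pow_mul]
  exact Nat.pow_le_pow_left Nat.lt_two_pow_self.le k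

/-- The binary logarithm of the budget is bounded by a polynomial in the size of the input. -/
noncomputable def budgetBound (p q : ℕ) : Polynomial ℕ :=
  open Polynomial in X + C p * X + C q * X + sizeBound p q ^ 2 + C 3

theorem budget_le (hp : 0 < p) (hq : 0 < q) :
    Context.budget g + 2 ≤ 2 ^ (budgetBound p q).eval (bitSize g.code) := by
  set s := bitSize g.code with hs
  set r := (sizeBound p q).eval s with hr
  set e := s + p * s + q * s + r ^ 2 with he
  have hE : (budgetBound p q).eval s = e + 3 := by simp [budgetBound, he, hr]
  have h0 := g.add_four_le_bitSize
  have hpow : ∀ b k, k ≤ s → b * s ≤ e → b ^ k ≤ 2 ^ e := fun b k hk hb =>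
    (pow_le_two_pow_mul b k).trans
      (Nat.pow_le_pow_right two_pos ((Nat.mul_le_mul_left _ hk).trans hb))
  have h1 : g.code.sum ≤ 2 ^ e := (sum_lt_two_pow_bitSize g.code).le.trans
    (Nat.pow_le_pow_right two_pos (by omega))
  have h2 : (∑ i ∈ Finset.range g.outputLength, g.entry i + 1) ^ g.outputLength ≤ 2 ^ e := by
    have h3 := g.bitSize_output_le hq
    have h4 : ∑ i ∈ Finset.range g.outputLength, g.entry i =
        (outputAutomaton hq g.spec g.scen g.strategy).encode.sum := by
      rw [← g.map_entry hp hq]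
      rfl
    have h5 : g.outputLength ≤ r :=
      ((ParityAutomaton.length_encode _).symm.trans_le (length_le_bitSize _)).trans h3
    rw [h4]
    have h6 := Nat.succ_le_of_lt ((sum_lt_two_pow_bitSize
      (outputAutomaton hq g.spec g.scen g.strategy).encode).trans_le
        (Nat.pow_le_pow_right two_pos h3))
    calc _ ≤ (2 ^ r) ^ r :=
          (Nat.pow_le_pow_left h6 _).trans (Nat.pow_le_pow_right (Nat.pow_pos two_pos) h5)
      _ = 2 ^ r ^ 2 := by rw [← pow_mul, pow_two]
      _ ≤ 2 ^ e := Nat.pow_le_pow_right two_pos (Nat.le_add_left _ _)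
  have h6 := hpow q (g.n + 1) (by omega) (by omega)
  have h7 := hpow p (g.n + 1) (by omega) (by omega)
  have h8 := hpow q (g.m + 1) (by omega) (by omega)
  have h9 := hpow p (g.m + 1) (by omega) (by omega)
  have h10 : 2 ≤ 2 ^ e * 2 := Nat.le_mul_of_pos_left _ (Nat.pow_pos two_pos)
  rw [hE, pow_add]
  change g.code.sum + (q ^ (g.n + 1) + p ^ (g.n + 1) + q ^ (g.m + 1) + p ^ (g.m + 1)) +
    (∑ i ∈ Finset.range g.outputLength, g.entry i + 1) ^ g.outputLength + 2 ≤ 2 ^ e * 8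
  omega

end AutomataPair

end Synthesis

theorem mainTheorem5 (p q : ℕ) (hp : 0 < p) (hq : 0 < q) :
    ∃ (c : Turing.ToPartrec.Code) (T R : Polynomial ℕ),
      ∀ (n m : ℕ)
        (ML : Synthesis.ParityAutomaton (Fin n) (Fin p) (Fin q))
        (MS : Synthesis.ParityAutomaton (Fin m) (Fin p) (Fin q))
        (L S : Synthesis.IOLang (Fin p) (Fin q)),
        ML.Recognises L → MS.Recognises S → Synthesis.Coherent S → S ⊆ L →
        ∃ (k : ℕ) (MA : Synthesis.ParityAutomaton (Fin k) (Fin p) (Fin q))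
          (A : Synthesis.IOLang (Fin p) (Fin q)),
          MA.Recognises A ∧
          Synthesis.EnsurableOptimal A L S ∧
          Synthesis.bitSize MA.encode ≤ R.eval (Synthesis.bitSize (ML.encode ++ MS.encode)) ∧
          Synthesis.ComputesInTime c (ML.encode ++ MS.encode) MA.encode
            (2 ^ T.eval (Synthesis.bitSize (ML.encode ++ MS.encode))) := by
  open Synthesis in
  have : Nonempty (Fin p) := ⟨⟨0, hp⟩⟩
  have : Nonempty (Fin q) := ⟨⟨0, hq⟩⟩
  obtain ⟨c, t, ⟨κ, hκ⟩, hc⟩ := AutomataPair.polyComputableList_map_entry hp hq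
  refine ⟨c, Polynomial.C κ * AutomataPair.budgetBound p q, AutomataPair.sizeBound p q,
    fun n m ML MS L S hL hS hcoh hSL => ?_⟩
  let g : AutomataPair p q := ⟨n, m, ML, MS⟩
  obtain ⟨hopt, hcoop⟩ := ensurableOptimal_controller hL.mem_iff hS.mem_iff hcoh hSL
    (good_goodNum hq g.codes_spec hp) (pick := lastLive hq MS) (live_lastLive hq)
  refine ⟨_, outputAutomaton hq ML MS g.strategy, _,
    (assumptionAutomaton_recognises hL.mem_iff hcoop).map _, hopt, g.bitSize_output_le hq, ?_⟩
  have h := hc g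
  simp only [g.map_entry hp hq] at h
  refine (h.mono ((hκ g).trans
    ((Nat.pow_le_pow_left (g.budget_le hp hq) κ).trans ?_))).computesInTime
  rw [← pow_mul, Polynomial.eval_mul, Polynomial.eval_C, Nat.mul_comm]
  rfl
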